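/- Let $(M^4, g)$ be a complete Riemannian manifold of dimension $4$ and let $f : M \to \mathbb{R}$ be a smooth function such that $$\mathrm{Ric} + \nabla^2 f = \tfrac12 g \qquad\text{and}\qquad |\nabla f|^2 = f \quad\text{on } M$$ (a normalized gradient shrinking Ricci soliton), and suppose that the scalar curvature $S$ of $g$ is constant equal to $1$. Regard $\mathrm{Ric}$ as an endomorphism of $TM$ by means of $g$, and let $\Delta_f u = \Delta u - \langle \nabla f, \nabla u\rangle$ denote the drifted Laplacian on functions. Then $$\Delta_f\Big[f\big(\mathrm{tr}(\mathrm{Ric}^3) - \tfrac14\big)\Big] \;\ge\; 9\, f\big(\mathrm{tr}(\mathrm{Ric}^3) - \tfrac14\big)\qquad\text{on all of } M .$$ -/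

import Mathlib

open scoped Manifold ContDiff Bundle

noncomputable section

namespace ChartGeom

/-- Coordinate space `ℝ⁴`. -/
abbrev E4 := EuclideanSpace ℝ (Fin 4)

/-- The partial derivative `∂ᵢ u` of a function on coordinate space. -/
def pd (i : Fin 4) (u : E4 → ℝ) (y : E4) : ℝ :=
  fderiv ℝ u y (EuclideanSpace.single i 1)

/-- The metric components `g_ij = ⟨∂ᵢ, ∂ⱼ⟩` in the chart `φ`, as functions of the coordinates
`y ∈ φ.target`; the coordinate vector field `∂ᵢ` at the point `φ⁻¹(y)` is the image of the `i`-th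
standard basis vector under the differential of `φ⁻¹`. -/
def metric {M : Type*} [TopologicalSpace M] [ChartedSpace E4 M]
    [Bundle.RiemannianBundle (fun x : M => TangentSpace (𝓡 4) x)]
    (φ : OpenPartialHomeomorph M E4) (y : E4) : Matrix (Fin 4) (Fin 4) ℝ :=
  Matrix.of fun i j =>
    inner ℝ (mfderiv (𝓡 4) (𝓡 4) φ.symm y (EuclideanSpace.single i (1 : ℝ) : E4))
      (mfderiv (𝓡 4) (𝓡 4) φ.symm y (EuclideanSpace.single j (1 : ℝ) : E4))

/-! In what follows `g` is a field of `4 × 4` matrices, the components of a metric in coordinates;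
`(g y)⁻¹ k l` is `g^{kl}`. -/

/-- The Christoffel symbols of the Levi-Civita connection,
`Γ^k_ij = ½ g^{kl} (∂ᵢ g_jl + ∂ⱼ g_il - ∂ₗ g_ij)`, so that `∇_{∂ᵢ} ∂ⱼ = Γ^k_ij ∂ₖ`. -/
def christoffel (g : E4 → Matrix (Fin 4) (Fin 4) ℝ) (k i j : Fin 4) (y : E4) : ℝ :=
  (1 / 2 : ℝ) * ∑ l, (g y)⁻¹ k l *
    (pd i (fun z => g z j l) y + pd j (fun z => g z i l) y - pd l (fun z => g z i j) y)

/-- The curvature tensor, with the sign convention `Rm(X, Y) = ∇²_{Y,X} - ∇²_{X,Y}`: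
`Rm(∂ᵢ, ∂ⱼ) ∂ₖ = ∑ₗ (curvature g l i j k) ∂ₗ`. -/
def curvature (g : E4 → Matrix (Fin 4) (Fin 4) ℝ) (l i j k : Fin 4) (y : E4) : ℝ :=
  pd j (christoffel g l i k) y - pd i (christoffel g l j k) y
    + ∑ m, (christoffel g l j m y * christoffel g m i k y
      - christoffel g l i m y * christoffel g m j k y)

/-- The Ricci tensor `Ric(X, Y) = tr Rm(X, ·, Y, ·)`, where `Rm(X, Y, Z, W) = g(Rm(X, Y) Z, W)`:
the component `R_ij = g^{kl} Rm(∂ᵢ, ∂ₖ, ∂ⱼ, ∂ₗ)` is the contraction of the upper index of the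
curvature with its second argument. -/
def ricci (g : E4 → Matrix (Fin 4) (Fin 4) ℝ) (y : E4) : Matrix (Fin 4) (Fin 4) ℝ :=
  Matrix.of fun i j => ∑ k, curvature g k i k j y

/-- The Ricci endomorphism `g^{ik} R_kj`. -/
def ricciEnd (g : E4 → Matrix (Fin 4) (Fin 4) ℝ) (y : E4) : Matrix (Fin 4) (Fin 4) ℝ :=
  (g y)⁻¹ * ricci g y

/-- The scalar curvature `S = tr Ric`. -/
def scalarCurvature (g : E4 → Matrix (Fin 4) (Fin 4) ℝ) (y : E4) : ℝ :=
  (ricciEnd g y).trace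

/-- The function `tr (Ric³)`. -/
def trRicCubed (g : E4 → Matrix (Fin 4) (Fin 4) ℝ) (y : E4) : ℝ :=
  (ricciEnd g y ^ 3).trace

/-- The Hessian `(∇²u)_ij = ∂ᵢ ∂ⱼ u - Γ^k_ij ∂ₖ u`. -/
def hessian (g : E4 → Matrix (Fin 4) (Fin 4) ℝ) (u : E4 → ℝ) (y : E4) :
    Matrix (Fin 4) (Fin 4) ℝ :=
  Matrix.of fun i j => pd i (pd j u) y - ∑ k, christoffel g k i j y * pd k u y

/-- The inner product of gradients `⟨∇u, ∇v⟩ = g^{ij} ∂ᵢ u ∂ⱼ v`. -/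
def gradInner (g : E4 → Matrix (Fin 4) (Fin 4) ℝ) (u v : E4 → ℝ) (y : E4) : ℝ :=
  ∑ i, ∑ j, (g y)⁻¹ i j * pd i u y * pd j v y

/-- The Laplace-Beltrami operator `Δu = tr ∇²u`. -/
def laplacian (g : E4 → Matrix (Fin 4) (Fin 4) ℝ) (u : E4 → ℝ) (y : E4) : ℝ :=
  ((g y)⁻¹ * hessian g u y).trace

/-- The drifted Laplacian `Δ_f u = Δu - ⟨∇f, ∇u⟩`. -/
def driftLaplacian (g : E4 → Matrix (Fin 4) (Fin 4) ℝ) (f u : E4 → ℝ) (y : E4) : ℝ :=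
  laplacian g u y - gradInner g f u y

end ChartGeom

end

/-! Write `h = tr(Ric³) - 1/4`. Differentiating `|∇f|² = f` and using the soliton equation gives
`Ric(∇f) = 0`. The commutator of covariant derivatives on `∇f` expresses `Rm(·,·)∇f` through `∇Ric`;
its contraction shows that `Ric` is divergence free. Contracting the derivative of `Ric(∇f) = 0`
then gives `tr(Ric²) = 1/2`. Commuting derivatives once more yields `Δ_f Ric = Ric - 2 Rm * Ric`
(`laplace_ric_of_identities`).

Where `∇f ≠ 0`, take an orthonormal eigenframe of `Ric` with first vector along `∇f`. The
eigenvalues are `0, a, b, c` with `a + b + c = 1` and `a² + b² + c² = 1/2`, so `a, b, c ≥ 0` and `h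
= 3abc`. The radial sectional curvatures come from `Rm(·,·)∇f`; since the complement of `∇f` is
three-dimensional, the Ricci eigenvalues then determine the other three. Substituting in `Δ_f(fh) =
h Δ_f f + 2⟨∇f,∇h⟩ + f Δ_f h`, everything except the terms quadratic in `∇Ric` adds up to exactly
`9fh` (`drift_identity`); the rest is `6f ∑ λ_a |∇_i R_ab|² ≥ 0` (`drift_estimate_at`).

Where `f = 0` also `∇f = 0`, and the claim reduces to `h ≥ 0`. This follows by continuity: if `f`
vanished near such a point, then `Ric = g/2` and `S = 2` there.

The calculus is carried out over a commutative algebra with four commuting derivations. Vector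
fields are represented by square matrices with equal columns, so that every tensor identity becomes
one in a noncommutative matrix ring. -/

set_option linter.unusedSectionVars false

noncomputable section

/-! ### Connection and curvature over an algebra of functions -/

/-- Coordinate data for a metric over an abstract algebra of functions: four commuting derivations
and a symmetric invertible matrix. -/
structure MetricAlgebra (R : Type*) [CommRing R] [Algebra ℝ R] where
  d : Fin 4 → Derivation ℝ R R
  d_comm : ∀ i j u, d i (d j u) = d j (d i u)
  g : Matrix (Fin 4) (Fin 4) R
  ginv : Matrix (Fin 4) (Fin 4) R
  g_mul_ginv : g * ginv = 1
  g_symm : g.transpose = g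

namespace MetricAlgebra

open Matrix

variable {R : Type*} [CommRing R] [Algebra ℝ R]

/-- Entrywise application of a derivation. -/
def mapD (D : Derivation ℝ R R) (X : Matrix (Fin 4) (Fin 4) R) : Matrix (Fin 4) (Fin 4) R :=
  X.map D

section mapD

variable (D : Derivation ℝ R R) (X Y : Matrix (Fin 4) (Fin 4) R)

@[simp] lemma mapD_apply (a b : Fin 4) : mapD D X a b = D (X a b) := rfl

lemma mapD_add : mapD D (X + Y) = mapD D X + mapD D Y := by ext; simp

lemma mapD_sub : mapD D (X - Y) = mapD D X - mapD D Y := by ext; simp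

lemma mapD_neg : mapD D (-X) = -mapD D X := by ext; simp

lemma mapD_zero : mapD D 0 = 0 := by ext; simp

lemma mapD_one : mapD D 1 = 0 := by
  ext a b; rw [mapD_apply, Matrix.one_apply]; split_ifs <;> simp

lemma mapD_mul : mapD D (X * Y) = mapD D X * Y + X * mapD D Y := by
  ext a b
  simp only [mapD_apply, Matrix.mul_apply, Matrix.add_apply, map_sum, Derivation.leibniz,
    smul_eq_mul, Finset.sum_add_distrib]
  rw [add_comm]
  congr 1
  exact Finset.sum_congr rfl fun _ _ => mul_comm _ _

lemma mapD_transpose : mapD D Xᵀ = (mapD D X)ᵀ := rfl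

lemma mapD_smul (c : ℝ) : mapD D (c • X) = c • mapD D X := by ext; simp

lemma trace_mapD : (mapD D X).trace = D X.trace := by
  simp [Matrix.trace]

end mapD

/-- A linear combination of three equations in a noncommutative setting; the identity `e` is left to
`noncomm_ring`. -/
lemma eq_of_sub_eq_sub_sub {A : Type*} [AddCommGroup A] {a b p q r s t u : A} (h : p = q)
    (h1 : r = s) (h2 : t = u) (e : a - b = p - q - (r - s) - (t - u)) : a = b := by
  subst h h1 h2
  simpa [sub_eq_zero] using e

variable (L : MetricAlgebra R)

lemma mapD_comm (i j : Fin 4) (X : Matrix (Fin 4) (Fin 4) R) :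
    mapD (L.d i) (mapD (L.d j) X) = mapD (L.d j) (mapD (L.d i) X) := by
  ext a b; simp [L.d_comm i j]

lemma ginv_mul_g : L.ginv * L.g = 1 := mul_eq_one_comm.mp L.g_mul_ginv

lemma g_apply_symm (i j : Fin 4) : L.g i j = L.g j i := by
  conv_lhs => rw [← L.g_symm, Matrix.transpose_apply]

lemma ginv_symm : L.ginvᵀ = L.ginv := by
  have h : L.ginvᵀ * L.g = 1 := by
    have := congrArg Matrix.transpose L.g_mul_ginv
    rwa [Matrix.transpose_mul, L.g_symm, Matrix.transpose_one] at this
  calc L.ginvᵀ = L.ginvᵀ * (L.g * L.ginv) := by rw [L.g_mul_ginv, mul_one]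
    _ = L.ginv := by rw [← mul_assoc, h, one_mul]

/-- Christoffel symbols of the first kind, doubled. -/
def chr (i : Fin 4) : Matrix (Fin 4) (Fin 4) R :=
  Matrix.of fun l k => L.d i (L.g k l) + L.d k (L.g i l) - L.d l (L.g i k)

/-- The connection matrices: `conn i l k = Γ^l_ik`. -/
def conn (i : Fin 4) : Matrix (Fin 4) (Fin 4) R := (1 / 2 : ℝ) • (L.ginv * L.chr i)

lemma conn_symm (i k l : Fin 4) : L.conn i l k = L.conn k l i := by
  simp only [conn, Matrix.smul_apply, Matrix.mul_apply, chr, Matrix.of_apply]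
  congr 1
  refine Finset.sum_congr rfl fun m _ => ?_
  rw [L.g_apply_symm i k]; ring

lemma g_mul_conn (i : Fin 4) : L.g * L.conn i = (1 / 2 : ℝ) • L.chr i := by
  rw [conn, Matrix.mul_smul, ← mul_assoc, L.g_mul_ginv, one_mul]

lemma mapD_g (i : Fin 4) : mapD (L.d i) L.g = (L.conn i)ᵀ * L.g + L.g * L.conn i := by
  have h : (L.conn i)ᵀ * L.g = (L.g * L.conn i)ᵀ := by rw [Matrix.transpose_mul, L.g_symm]
  rw [h, g_mul_conn]
  ext a b
  simp only [mapD_apply, Matrix.add_apply, Matrix.transpose_apply, Matrix.smul_apply, chr,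
    Matrix.of_apply]
  rw [L.g_apply_symm b a, ← smul_add,
    show ∀ x y z : R, x + y - z + (x + z - y) = (2 : ℝ) • x by
      intro x y z; rw [two_smul]; ring, smul_smul]
  norm_num

/-- The matrix all of whose columns are the `j`-th standard basis vector. -/
def col (j : Fin 4) : Matrix (Fin 4) (Fin 4) R := Matrix.of fun l _ => if l = j then 1 else 0

@[simp] lemma mul_col_apply (X : Matrix (Fin 4) (Fin 4) R) (j a b : Fin 4) :
    (X * (col j : Matrix (Fin 4) (Fin 4) R)) a b = X a j := by
  simp [Matrix.mul_apply, col]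

lemma mapD_col (D : Derivation ℝ R R) (j : Fin 4) :
    mapD D (col j : Matrix (Fin 4) (Fin 4) R) = 0 := by
  ext a b; simp only [mapD_apply, col, Matrix.of_apply]; split_ifs <;> simp

/-- Absence of torsion, `∇_i ∂_j = ∇_j ∂_i`, in matrix form. -/
lemma conn_mul_col (i j : Fin 4) : L.conn i * col j = L.conn j * col i := by
  ext a b; simp [L.conn_symm i j]

/-- The curvature matrices `F_ij = [∇_i, ∇_j]`. -/
def curv (i j : Fin 4) : Matrix (Fin 4) (Fin 4) R :=
  mapD (L.d i) (L.conn j) - mapD (L.d j) (L.conn i) + L.conn i * L.conn j - L.conn j * L.conn i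

/-- Covariant derivative of an endomorphism field, not acting on other indices. -/
def cov (i : Fin 4) (X : Matrix (Fin 4) (Fin 4) R) : Matrix (Fin 4) (Fin 4) R :=
  mapD (L.d i) X + L.conn i * X - X * L.conn i

/-- Covariant derivative of a matrix whose columns are vector fields. -/
def covV (i : Fin 4) (X : Matrix (Fin 4) (Fin 4) R) : Matrix (Fin 4) (Fin 4) R :=
  mapD (L.d i) X + L.conn i * X

lemma curv_antisymm (i j : Fin 4) : L.curv i j = -L.curv j i := by
  simp only [curv]; abel

lemma cov_sub (i : Fin 4) (X Y) : L.cov i (X - Y) = L.cov i X - L.cov i Y := by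
  simp only [cov, mapD_sub]; noncomm_ring

lemma covV_add (i : Fin 4) (X Y) : L.covV i (X + Y) = L.covV i X + L.covV i Y := by
  simp only [covV, mapD_add]; noncomm_ring

lemma covV_sub (i : Fin 4) (X Y) : L.covV i (X - Y) = L.covV i X - L.covV i Y := by
  simp only [covV, mapD_sub]; noncomm_ring

lemma covV_zero (i : Fin 4) : L.covV i 0 = 0 := by simp [covV, mapD_zero]

lemma cov_one (i : Fin 4) : L.cov i 1 = 0 := by simp [cov, mapD_one]

lemma cov_smul (i : Fin 4) (c : ℝ) (X) : L.cov i (c • X) = c • L.cov i X := by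
  simp only [cov, mapD_smul, Matrix.mul_smul, Matrix.smul_mul, smul_add, smul_sub]

lemma cov_mul (i : Fin 4) (X Y) : L.cov i (X * Y) = L.cov i X * Y + X * L.cov i Y := by
  simp only [cov, mapD_mul]; noncomm_ring

lemma covV_mul (i : Fin 4) (X Y) : L.covV i (X * Y) = L.cov i X * Y + X * L.covV i Y := by
  simp only [cov, covV, mapD_mul]; noncomm_ring

lemma covV_col (i j : Fin 4) : L.covV i (col j) = L.conn i * col j := by
  simp [covV, mapD_col]

lemma covV_mul_col (i j : Fin 4) (X) :
    L.covV i (X * col j) = L.cov i X * col j + X * (L.conn i * col j) := by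
  rw [covV_mul, covV_col]

lemma d_trace (i : Fin 4) (X) : L.d i X.trace = (L.cov i X).trace := by
  simp only [cov, Matrix.trace_add, Matrix.trace_sub, trace_mapD]
  rw [Matrix.trace_mul_comm X]; ring

lemma covV_comm (i j : Fin 4) (X) :
    L.covV i (L.covV j X) - L.covV j (L.covV i X) = L.curv i j * X := by
  simp only [covV, curv, mapD_add, mapD_mul, L.mapD_comm i j]; noncomm_ring

lemma cov_comm (i j : Fin 4) (X) :
    L.cov i (L.cov j X) - L.cov j (L.cov i X) = L.curv i j * X - X * L.curv i j := by
  simp only [cov, curv, mapD_add, mapD_sub, mapD_mul, L.mapD_comm i j]; noncomm_ring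

/-- The metric is parallel, so expanding `∂_i ∂_j g = ∂_j ∂_i g` by `mapD_g` leaves only the action
of the curvature on `g`. -/
lemma curv_skew (i j : Fin 4) : (L.curv i j)ᵀ * L.g = -(L.g * L.curv i j) := by
  have h := L.mapD_comm i j L.g
  simp only [mapD_g, mapD_add, mapD_mul, mapD_transpose] at h
  have h' := sub_eq_zero.mpr h
  rw [eq_neg_iff_add_eq_zero, ← h']
  simp only [curv, Matrix.transpose_add, Matrix.transpose_sub, Matrix.transpose_mul]
  noncomm_ring

lemma curv_bianchi (i j k : Fin 4) :
    L.curv i j * col k + L.curv j k * col i + L.curv k i * col j = 0 := by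
  have hd : ∀ i j k, mapD (L.d i) (L.conn j) * (col k : Matrix (Fin 4) (Fin 4) R)
      = mapD (L.d i) (L.conn k) * col j := by
    intro i j k; ext a b; simp [L.conn_symm j k]
  simp only [curv, add_mul, sub_mul, mul_assoc]
  rw [hd i j k, hd j i k, hd k i j, L.conn_mul_col j k, L.conn_mul_col i k, L.conn_mul_col i j]
  abel

/-- The Jacobi identity for the operators `∇_i`. The form indices are not yet differentiated
covariantly; `covCurv_bianchi` adds the corrections, which cancel by symmetry of the Christoffel
symbols. -/
lemma cov_curv_bianchi (i j k : Fin 4) :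
    L.cov i (L.curv j k) + L.cov j (L.curv k i) + L.cov k (L.curv i j) = 0 := by
  simp only [cov, curv, mapD_add, mapD_sub, mapD_mul, L.mapD_comm j i, L.mapD_comm k i,
    L.mapD_comm k j]
  noncomm_ring

lemma cov_selfAdjoint (i : Fin 4) (X) (hX : Xᵀ * L.g = L.g * X) :
    (L.cov i X)ᵀ * L.g = L.g * L.cov i X := by
  have h := congrArg (mapD (L.d i)) hX
  simp only [mapD_g, mapD_mul, mapD_transpose] at h
  simp only [cov, Matrix.transpose_add, Matrix.transpose_sub, Matrix.transpose_mul]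
  have h1 : (L.conn i)ᵀ * (Xᵀ * L.g) = (L.conn i)ᵀ * (L.g * X) := by rw [hX]
  have h2 : Xᵀ * L.g * L.conn i = L.g * X * L.conn i := by rw [hX]
  refine eq_of_sub_eq_sub_sub h h1 h2 ?_
  noncomm_ring

lemma cov_skewAdjoint (i : Fin 4) (X) (hX : Xᵀ * L.g = -(L.g * X)) :
    (L.cov i X)ᵀ * L.g = -(L.g * L.cov i X) := by
  have h := congrArg (mapD (L.d i)) hX
  simp only [mapD_g, mapD_mul, mapD_transpose, mapD_neg] at h
  simp only [cov, Matrix.transpose_add, Matrix.transpose_sub, Matrix.transpose_mul]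
  have h1 : (L.conn i)ᵀ * (Xᵀ * L.g) = -((L.conn i)ᵀ * (L.g * X)) := by rw [hX, mul_neg]
  have h2 : Xᵀ * L.g * L.conn i = -(L.g * X * L.conn i) := by rw [hX, neg_mul]
  refine eq_of_sub_eq_sub_sub h h1 h2 ?_
  noncomm_ring

lemma half_smul_two_mul (x : R) : (1 / 2 : ℝ) • (2 * x) = x := by
  rw [two_mul, ← two_smul ℝ x, smul_smul]; norm_num

/-! ### First-order identities of the soliton -/

/-- The Ricci tensor. -/
def ric : Matrix (Fin 4) (Fin 4) R := Matrix.of fun i j => ∑ k, L.curv k i k j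

/-- The Ricci endomorphism. -/
def ricE : Matrix (Fin 4) (Fin 4) R := L.ginv * L.ric

/-- The Hessian of a function. -/
def hess (u : R) : Matrix (Fin 4) (Fin 4) R :=
  Matrix.of fun i j => L.d i (L.d j u) - ∑ k, L.conn i k j * L.d k u

/-- The matrix all of whose columns are the gradient of a function. -/
def grad (u : R) : Matrix (Fin 4) (Fin 4) R :=
  Matrix.of fun l _ => ∑ m, L.ginv l m * L.d m u

/-- The matrix all of whose columns are the differential of a function. -/
def diff (u : R) : Matrix (Fin 4) (Fin 4) R := Matrix.of fun l _ => L.d l u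

/-- The inner product of two gradients. -/
def gradInner (u w : R) : R := ∑ i, ∑ j, L.ginv i j * L.d i u * L.d j w

/-- The drifted Laplacian. -/
def driftLap (f u : R) : R := (L.ginv * L.hess u).trace - L.gradInner f u

/-- Coordinate data of a normalized shrinking soliton of scalar curvature one. -/
structure IsSoliton (f : R) : Prop where
  eq : L.ric + L.hess f = (1 / 2 : ℝ) • L.g
  norm : L.gradInner f f = f
  scal : L.ricE.trace = 1

lemma hess_symm (u : R) : (L.hess u)ᵀ = L.hess u := by
  ext i j
  simp only [hess, Matrix.transpose_apply, Matrix.of_apply]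
  rw [L.d_comm]
  congr 1
  exact Finset.sum_congr rfl fun k _ => by rw [L.conn_symm]

lemma grad_eq (u : R) : L.grad u = L.ginv * L.diff u := by
  ext l c; simp [grad, diff, Matrix.mul_apply]

lemma g_mul_grad (u : R) : L.g * L.grad u = L.diff u := by
  rw [grad_eq, ← mul_assoc, L.g_mul_ginv, one_mul]

lemma mul_left_cancel_g {X Y : Matrix (Fin 4) (Fin 4) R} (h : L.g * X = L.g * Y) : X = Y := by
  have := congrArg (L.ginv * ·) h
  simpa only [← mul_assoc, L.ginv_mul_g, one_mul] using this

/-- Differentiate `g ∇u = du` and use that `g` is parallel. -/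
lemma covV_grad (u : R) (i : Fin 4) :
    L.covV i (L.grad u) = L.ginv * L.hess u * col i := by
  apply L.mul_left_cancel_g
  rw [mul_assoc, ← mul_assoc L.g, L.g_mul_ginv, one_mul]
  have h := congrArg (mapD (L.d i)) (L.g_mul_grad u)
  rw [mapD_mul, mapD_g] at h
  have h2 : (L.conn i)ᵀ * (L.g * L.grad u) = (L.conn i)ᵀ * L.diff u := by rw [g_mul_grad]
  have h3 : mapD (L.d i) (L.diff u) - (L.conn i)ᵀ * L.diff u = L.hess u * col i := by
    rw [← L.hess_symm u]
    ext a b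
    rw [mul_col_apply]
    simp [hess, diff, Matrix.mul_apply]
  rw [← h3, covV, ← h2, ← h]
  noncomm_ring

namespace IsSoliton

variable {L} {f : R} (H : L.IsSoliton f)
include H

lemma ginv_mul_hess :
    L.ginv * L.hess f = (1 / 2 : ℝ) • (1 : Matrix (Fin 4) (Fin 4) R) - L.ricE := by
  have h := congrArg (L.ginv * ·) H.eq
  simp only [mul_add, Matrix.mul_smul, L.ginv_mul_g] at h
  rw [ricE, ← h]; abel

lemma covV_grad (i : Fin 4) :
    L.covV i (L.grad f) = ((1 / 2 : ℝ) • (1 : Matrix (Fin 4) (Fin 4) R) - L.ricE) * col i := by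
  rw [L.covV_grad, H.ginv_mul_hess]

/-- The soliton equation makes `Ric` a difference of two symmetric tensors, so pair symmetry of the
curvature is not needed here. -/
lemma ric_symm : L.ricᵀ = L.ric := by
  have h : L.ric = (1 / 2 : ℝ) • L.g - L.hess f := by rw [← H.eq]; abel
  rw [h, Matrix.transpose_sub, Matrix.transpose_smul, L.g_symm, L.hess_symm]

lemma g_mul_ricE : L.g * L.ricE = L.ric := by
  rw [ricE, ← mul_assoc, L.g_mul_ginv, one_mul]

lemma ricE_selfAdjoint : L.ricEᵀ * L.g = L.g * L.ricE := by
  rw [H.g_mul_ricE, ricE, Matrix.transpose_mul, L.ginv_symm, mul_assoc, L.ginv_mul_g, mul_one,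
    H.ric_symm]

/-- Differentiating `|∇f|² = f` gives `df = 2 ∇²f(∇f, ·) = df - 2 Ric(∇f, ·)`. -/
lemma ricE_mul_grad : L.ricE * L.grad f = 0 := by
  have hn : L.gradInner f f = ((L.grad f)ᵀ * L.g * L.grad f) 0 0 := by
    rw [mul_assoc, L.g_mul_grad]
    simp only [gradInner, Matrix.mul_apply, Matrix.transpose_apply, grad, diff, Matrix.of_apply,
      Finset.sum_mul]
    refine Finset.sum_congr rfl fun i _ => Finset.sum_congr rfl fun j _ => ?_
    ring
  rw [H.norm] at hn
  have hd : L.ricEᵀ * L.diff f = 0 := by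
    ext i c
    have h1 : L.d i f = ((L.covV i (L.grad f))ᵀ * L.g * L.grad f
        + (L.grad f)ᵀ * L.g * L.covV i (L.grad f)) 0 0 := by
      conv_lhs => rw [hn, ← mapD_apply]
      refine congrFun (congrFun (?_ : _ = _) 0) 0
      rw [mapD_mul, mapD_mul, mapD_g, mapD_transpose]
      simp only [covV, Matrix.transpose_add, Matrix.transpose_mul]
      noncomm_ring
    have h2 : (L.grad f)ᵀ * L.g * L.covV i (L.grad f)
        = ((L.covV i (L.grad f))ᵀ * L.g * L.grad f)ᵀ := by
      simp only [Matrix.transpose_mul, Matrix.transpose_transpose, L.g_symm, mul_assoc]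
    have h3 : (L.covV i (L.grad f))ᵀ * L.g * L.grad f
        = (col i)ᵀ * ((1 / 2 : ℝ) • L.diff f - L.ricEᵀ * L.diff f) := by
      rw [mul_assoc, g_mul_grad, H.covV_grad, Matrix.transpose_mul, mul_assoc,
        Matrix.transpose_sub, Matrix.transpose_smul, Matrix.transpose_one, sub_mul,
        Matrix.smul_mul, one_mul]
    have h4 : ∀ X : Matrix (Fin 4) (Fin 4) R,
        ((col i : Matrix (Fin 4) (Fin 4) R)ᵀ * X) 0 0 = X i 0 := by
      intro X; simp [Matrix.mul_apply, col]
    rw [h2, Matrix.add_apply, Matrix.transpose_apply, h3, h4, ← two_mul, Matrix.sub_apply,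
      Matrix.smul_apply, mul_sub, mul_smul_comm] at h1
    have h5 : L.diff f i 0 = L.d i f := rfl
    have h6 : (L.ricEᵀ * L.diff f) i c = (L.ricEᵀ * L.diff f) i 0 := by
      simp [Matrix.mul_apply, diff]
    have h7 : (1 / 2 : ℝ) • (2 * L.d i f) = L.d i f := by
      exact half_smul_two_mul _
    rw [h5, h7] at h1
    have h8 : 2 * (L.ricEᵀ * L.diff f) i 0 = 0 := by linear_combination h1
    rw [h6, Matrix.zero_apply]
    have := congrArg ((1 / 2 : ℝ) • ·) h8
    simp only [smul_zero] at this
    rw [← this, half_smul_two_mul]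
  apply L.mul_left_cancel_g
  rw [← mul_assoc, ← H.ricE_selfAdjoint, mul_assoc, g_mul_grad, hd, mul_zero]

lemma trace_cov (i : Fin 4) : (L.cov i L.ricE).trace = 0 := by
  rw [← L.d_trace, H.scal]; simp

/-- `∇_i Ric (∂_j) - ∇_j Ric (∂_i) = Rm(∂_j, ∂_i) ∇f`. -/
lemma curv_mul_grad (i j : Fin 4) :
    L.curv i j * L.grad f = L.cov j L.ricE * col i - L.cov i L.ricE * col j := by
  have e : ∀ k, L.cov k ((1 / 2 : ℝ) • (1 : Matrix (Fin 4) (Fin 4) R) - L.ricE)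
      = -L.cov k L.ricE := by
    intro k; rw [cov_sub, cov_smul, cov_one, smul_zero, zero_sub]
  rw [← L.covV_comm, H.covV_grad, H.covV_grad, covV_mul_col, covV_mul_col, e, e,
    L.conn_mul_col j i]
  noncomm_ring

lemma ric_mul_grad (i c : Fin 4) : ∑ m, L.ric i m * L.grad f m c = 0 := by
  have h := congrArg (L.g * ·) H.ricE_mul_grad
  simp only [mul_zero] at h
  rw [← mul_assoc, H.g_mul_ricE] at h
  simpa [Matrix.mul_apply] using congrFun (congrFun h i) c

/-- The Ricci tensor is divergence free. -/
lemma div_ricE (i : Fin 4) : ∑ k, L.cov k L.ricE k i = 0 := by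
  -- The trace over `k` of the left side is `Ric(∂_i, ∇f) = 0`; on the right the first term traces
  -- to `∂_i S = 0`, leaving the divergence.
  have h : ∀ k, (L.curv k i * L.grad f) k 0 = L.cov i L.ricE k k - L.cov k L.ricE k i := by
    intro k; rw [H.curv_mul_grad]; simp
  have h1 : ∑ k, (L.curv k i * L.grad f) k 0 = 0 := by
    rw [← H.ric_mul_grad i 0]
    simp only [Matrix.mul_apply, ric, Matrix.of_apply, Finset.sum_mul]
    rw [Finset.sum_comm]
  simp only [h, Finset.sum_sub_distrib] at h1
  have h2 := H.trace_cov i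
  simp only [Matrix.trace, Matrix.diag_apply] at h2
  rw [h2, zero_sub, neg_eq_zero] at h1
  exact h1

lemma cov_mul_grad (i : Fin 4) : L.cov i L.ricE * L.grad f
    = -(L.ricE * (((1 / 2 : ℝ) • (1 : Matrix (Fin 4) (Fin 4) R) - L.ricE) * col i)) := by
  have h := congrArg (L.covV i) H.ricE_mul_grad
  rw [covV_mul, H.covV_grad, covV_zero] at h
  exact eq_neg_of_add_eq_zero_left h

/-- Contract `cov_mul_grad`: the left side is the divergence of `Ric` paired with `∇f`, hence zero,
which leaves `tr(Ric²) = S/2`. -/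
lemma trace_sq : (L.ricE * L.ricE).trace = algebraMap ℝ R (1 / 2) := by
  have h : ∑ i, (L.cov i L.ricE * L.grad f) i 0 = 0 := by
    simp only [Matrix.mul_apply]
    rw [Finset.sum_comm]
    refine Finset.sum_eq_zero fun m _ => ?_
    rw [← Finset.sum_mul, H.div_ricE, zero_mul]
  have h2 : ∀ i, (L.cov i L.ricE * L.grad f) i 0
      = (L.ricE * L.ricE - (1 / 2 : ℝ) • L.ricE) i i := by
    intro i
    rw [H.cov_mul_grad, ← mul_assoc, Matrix.neg_apply, mul_col_apply, ← Matrix.neg_apply,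
      mul_sub, Matrix.mul_smul, mul_one, neg_sub]
  simp only [h2] at h
  change (L.ricE * L.ricE - (1 / 2 : ℝ) • L.ricE).trace = 0 at h
  rw [Matrix.trace_sub, Matrix.trace_smul, H.scal, sub_eq_zero] at h
  rw [h, Algebra.smul_def, mul_one]

lemma trace_mul_cov (i : Fin 4) : 2 * (L.ricE * L.cov i L.ricE).trace = 0 := by
  have h := congrArg (L.d i) H.trace_sq
  rw [L.d_trace, cov_mul, Matrix.trace_add, Matrix.trace_mul_comm, Derivation.map_algebraMap] at h
  rw [two_mul, h]

end IsSoliton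

/-! ### Second derivatives of Ricci and first derivatives of curvature -/

/-- The covariant derivative of the Ricci endomorphism. -/
def covRic (k : Fin 4) : Matrix (Fin 4) (Fin 4) R := L.cov k L.ricE

/-- The second covariant derivative of the Ricci endomorphism. -/
def covRic2 (j k : Fin 4) : Matrix (Fin 4) (Fin 4) R :=
  L.cov j (L.covRic k) - ∑ m, L.conn j m k • L.covRic m

/-- The covariant derivative of the curvature. -/
def covCurv (k i j : Fin 4) : Matrix (Fin 4) (Fin 4) R :=
  L.cov k (L.curv i j) - ∑ m, L.conn k m i • L.curv m j - ∑ m, L.conn k m j • L.curv i m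

/-- The Ricci identity: the Christoffel corrections are symmetric in `j, k` and drop out. -/
lemma covRic2_comm (j k : Fin 4) :
    L.covRic2 j k - L.covRic2 k j = L.curv j k * L.ricE - L.ricE * L.curv j k := by
  simp only [covRic2, ← L.cov_comm, covRic]
  rw [Finset.sum_congr rfl fun m _ => by rw [L.conn_symm j k m]]
  abel

lemma covCurv_antisymm (k i j : Fin 4) : L.covCurv k i j = -L.covCurv k j i := by
  have h : ∀ c : Fin 4 → R, ∀ i, ∑ m, c m • L.curv i m = -∑ m, c m • L.curv m i := by
    intro c i
    rw [← Finset.sum_neg_distrib]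
    exact Finset.sum_congr rfl fun m _ => by rw [L.curv_antisymm i m, smul_neg]
  have h' : L.cov k (L.curv i j) = -L.cov k (L.curv j i) := by
    rw [L.curv_antisymm i j, ← zero_sub, cov_sub, ← zero_sub (L.cov k _)]
    congr 1
    simp [cov, mapD_zero]
  simp only [covCurv, h, h']
  abel

lemma covCurv_skew (k i j : Fin 4) : (L.covCurv k i j)ᵀ * L.g = -(L.g * L.covCurv k i j) := by
  simp only [covCurv, Matrix.transpose_sub, Matrix.transpose_sum, Matrix.transpose_smul, sub_mul,
    mul_sub, Finset.sum_mul, Finset.mul_sum, Matrix.smul_mul, Matrix.mul_smul, curv_skew, smul_neg,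
    L.cov_skewAdjoint k _ (L.curv_skew i j), Finset.sum_neg_distrib]
  abel

lemma covCurv_bianchi (i j k : Fin 4) :
    L.covCurv i j k + L.covCurv j k i + L.covCurv k i j = 0 := by
  have h : ∀ c : Fin 4 → R, ∀ i, ∑ m, c m • L.curv i m = -∑ m, c m • L.curv m i := by
    intro c i
    rw [← Finset.sum_neg_distrib]
    exact Finset.sum_congr rfl fun m _ => by rw [L.curv_antisymm i m, smul_neg]
  rw [← L.cov_curv_bianchi i j k]
  simp only [covCurv, h, L.conn_symm j i, L.conn_symm k i, L.conn_symm k j]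
  abel

lemma sum_conn_smul_col (i j : Fin 4) :
    ∑ m, L.conn i m j • (col m : Matrix (Fin 4) (Fin 4) R) = L.conn i * col j := by
  ext a b
  rw [mul_col_apply, Matrix.sum_apply]
  simp [col]

lemma covCurv_bianchi_first (m i j k : Fin 4) :
    L.covCurv m i j * col k + L.covCurv m j k * col i + L.covCurv m k i * col j = 0 := by
  have h0 := congrArg (L.covV m) (L.curv_bianchi i j k)
  simp only [covV_add, covV_mul_col, covV_zero, ← sum_conn_smul_col] at h0
  -- The Christoffel corrections for each of the three cyclic indices again form Bianchi sums.
  have hs : ∀ c : Fin 4 → R, ∀ i j, ∑ p, (c p • (L.curv p i * col j) + c p • (L.curv i j * col p)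
      + c p • (L.curv j p * col i)) = 0 := by
    intro c i j
    refine Finset.sum_eq_zero fun p _ => ?_
    rw [← smul_add, ← smul_add, L.curv_bianchi, smul_zero]
  simp only [Finset.sum_add_distrib] at hs
  have h1 := hs (L.conn m · i) j k
  have h2 := hs (L.conn m · j) k i
  have h3 := hs (L.conn m · k) i j
  simp only [covCurv, sub_mul, Finset.sum_mul, Finset.mul_sum, Matrix.smul_mul, Matrix.mul_smul]
    at h0 ⊢
  rw [← sub_zero (0 : Matrix (Fin 4) (Fin 4) R), ← sub_zero ((0 : Matrix (Fin 4) (Fin 4) R) - 0),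
    ← sub_zero ((0 : Matrix (Fin 4) (Fin 4) R) - 0 - 0)]
  nth_rw 1 [← h0]
  nth_rw 1 [← h1]
  nth_rw 1 [← h2]
  rw [← h3]
  abel

namespace IsSoliton

variable {L} {f : R} (H : L.IsSoliton f)
include H

lemma covRic2_div (i j : Fin 4) : ∑ k, L.covRic2 i k k j = 0 := by
  have hd : ∀ j, ∑ k, L.covRic k k j = 0 := H.div_ricE
  have h1 : ∑ k, L.d i (L.covRic k k j) = 0 := by rw [← map_sum, hd, map_zero]
  have h2 : ∑ k, ∑ m, L.conn i k m * L.covRic k m j = ∑ k, ∑ m, L.conn i m k * L.covRic m k j :=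
    Finset.sum_comm
  have h3 : ∑ k, ∑ m, L.covRic k k m * L.conn i m j = 0 := by
    rw [Finset.sum_comm]
    exact Finset.sum_eq_zero fun m _ => by rw [← Finset.sum_mul, hd, zero_mul]
  simp only [covRic2, cov, Matrix.sub_apply, Matrix.add_apply, mapD_apply, Matrix.mul_apply,
    Matrix.sum_apply, Matrix.smul_apply, smul_eq_mul, Finset.sum_add_distrib,
    Finset.sum_sub_distrib]
  rw [h1, h3]
  linear_combination h2

lemma covCurv_trace (m i j : Fin 4) : ∑ k, L.covCurv m k i k j = (L.g * L.covRic m) i j := by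
  have hr : ∀ i j, ∑ k, L.curv k i k j = L.ric i j := fun _ _ => rfl
  have e : L.g * L.covRic m = mapD (L.d m) L.ric - (L.conn m)ᵀ * L.ric - L.ric * L.conn m := by
    rw [← H.g_mul_ricE, covRic, cov, mapD_mul, mapD_g]; noncomm_ring
  rw [e]
  simp only [covCurv, cov, Matrix.sub_apply, Matrix.add_apply, mapD_apply, Matrix.mul_apply,
    Matrix.sum_apply, Matrix.smul_apply, smul_eq_mul, Finset.sum_add_distrib,
    Finset.sum_sub_distrib, Matrix.transpose_apply]
  have h1 : ∑ k, L.d m (L.curv k i k j) = L.d m (L.ric i j) := by rw [← map_sum, hr]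
  have h2 : ∑ k, ∑ p, L.conn m k p * L.curv k i p j = ∑ k, ∑ p, L.conn m p k * L.curv p i k j :=
    Finset.sum_comm
  have h3 : ∑ k, ∑ p, L.curv k i k p * L.conn m p j = ∑ p, L.ric i p * L.conn m p j := by
    rw [Finset.sum_comm]
    exact Finset.sum_congr rfl fun p _ => by rw [← Finset.sum_mul, hr]
  have h4 : ∑ k, ∑ p, L.conn m p i * L.curv k p k j = ∑ p, L.conn m p i * L.ric p j := by
    rw [Finset.sum_comm]
    exact Finset.sum_congr rfl fun p _ => by rw [← Finset.mul_sum, hr]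
  rw [h1, h3, h4]
  linear_combination h2

/-- The covariant derivative of `curv_mul_grad`, with `∇²f` replaced by `1/2 - Ric`. -/
lemma covRic2_mul_col (i j k : Fin 4) :
    L.covRic2 j k * col i - L.covRic2 j i * col k = L.covCurv j i k * L.grad f
      + L.curv i k * (((1 / 2 : ℝ) • (1 : Matrix (Fin 4) (Fin 4) R) - L.ricE) * col j) := by
  have hC : ∀ i j, L.curv i j * L.grad f = L.covRic j * col i - L.covRic i * col j :=
    H.curv_mul_grad
  have h := congrArg (L.covV j) (hC i k)
  rw [covV_mul, H.covV_grad, covV_sub, covV_mul_col, covV_mul_col, ← sum_conn_smul_col,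
    ← sum_conn_smul_col] at h
  simp only [covCurv, covRic2, sub_mul, Finset.sum_mul, Matrix.smul_mul, hC] at h ⊢
  simp only [Finset.mul_sum, Matrix.mul_smul, smul_sub, Finset.sum_sub_distrib] at h ⊢
  rw [← sub_eq_zero] at h ⊢
  rw [← neg_eq_zero, ← h]
  abel

end IsSoliton

end MetricAlgebra

/-! ### Index identities in an orthonormal frame and eigenvalue algebra -/

/-- Pair symmetry of algebraic curvature tensors. -/
lemma pair_symm_of_bianchi {K : Fin 4 → Fin 4 → Fin 4 → Fin 4 → ℝ}
    (h1 : ∀ i j a b, K i j a b = -K j i a b) (h2 : ∀ i j a b, K i j a b = -K i j b a)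
    (h3 : ∀ i j k a, K i j a k + K j k a i + K k i a j = 0) (i j a b : Fin 4) :
    K i j a b = K b a j i := by
  linarith [h3 i j a b, h3 i j b a, h3 j a i b, h3 j a b i, h3 a b i j, h3 a b j i, h3 b i a j,
    h3 b i j a, h1 i j a b, h1 j a i b, h1 a b i j, h1 b i a j, h1 i a j b, h1 j b i a,
    h2 i j a b, h2 j a i b, h2 a b i j, h2 b i a j, h2 i a j b, h2 j b i a,
    h1 j i a b, h1 a j i b, h1 b a i j, h1 i b a j, h1 a i j b, h1 b j i a,
    h2 j i a b, h2 a j i b, h2 b a i j, h2 i b a j, h2 a i j b, h2 b j i a,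
    h1 i j b a, h1 j a b i, h1 a b j i, h1 b i j a, h1 i a b j, h1 j b a i]

/-- The drifted Laplacian of the Ricci tensor of a gradient shrinking soliton, at a point with
orthonormal coordinate frame. -/
lemma laplace_ric_of_identities {E : Fin 4 → Fin 4 → ℝ} {T : Fin 4 → Fin 4 → Fin 4 → ℝ}
    {S F : Fin 4 → Fin 4 → Fin 4 → Fin 4 → ℝ} {W : Fin 4 → Fin 4 → Fin 4 → Fin 4 → Fin 4 → ℝ}
    {v : Fin 4 → ℝ}
    (hE : ∀ a b, E a b = E b a) (hT : ∀ i a b, T i a b = T i b a)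
    (hS : ∀ i j a b, S i j a b = S i j b a)
    (hScomm : ∀ j k a b, S j k a b - S k j a b = ∑ c, F j k a c * E c b - ∑ c, E a c * F j k c b)
    (hScol : ∀ i j k a, S j k a i - S j i a k
      = ∑ c, W j i k a c * v c + ((1 / 2) * F i k a j - ∑ c, F i k a c * E c j))
    (hSdiv : ∀ i j, ∑ k, S i k k j = 0)
    (hF1 : ∀ i j a b, F i j a b = -F j i a b) (hF2 : ∀ i j a b, F i j a b = -F i j b a)
    (hFric : ∀ i j, ∑ k, F k i k j = E i j)
    (hW1 : ∀ m i j a b, W m i j a b = -W m j i a b) (hW2 : ∀ m i j a b, W m i j a b = -W m i j b a)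
    (hW3 : ∀ m i j k a, W m i j a k + W m j k a i + W m k i a j = 0)
    (hW4 : ∀ i j k a b, W i j k a b + W j k i a b + W k i j a b = 0)
    (hWric : ∀ m i j, ∑ k, W m k i k j = T m i j)
    (hTv : ∀ i a, ∑ c, T i a c * v c = -((1 / 2) * E a i - ∑ c, E a c * E c i)) (i l : Fin 4) :
    ∑ k, S k k l i - ∑ c, v c * T c l i = E l i + 2 * ∑ k, ∑ c, F k i l c * E c k := by
  -- Trace of `hScol`: the rough Laplacian becomes a mixed second derivative plus a divergence of
  -- the curvature and curvature terms.
  have e1 : ∑ k, S k k l i - ∑ k, S k i l k = ∑ k, ∑ c, W k i k l c * v c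
      + ((1 / 2) * ∑ k, F i k l k - ∑ k, ∑ c, F i k l c * E c k) := by
    rw [Finset.mul_sum, ← Finset.sum_sub_distrib, ← Finset.sum_sub_distrib,
      ← Finset.sum_add_distrib]
    exact Finset.sum_congr rfl fun k _ => hScol i k k l
  -- Exchanging the two derivatives puts the divergence of `Ric` inside, where it vanishes; only the
  -- commutator remains.
  have e2 : ∑ k, S k i l k = ∑ k, ∑ c, F k i l c * E c k + ∑ c, E l c * E c i := by
    have h : ∀ k, S k i l k = S i k k l + (∑ c, F k i l c * E c k + ∑ c, E l c * F k i k c) := by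
      intro k
      have h' : ∑ c, E l c * F k i k c = -∑ c, E l c * F k i c k := by
        rw [← Finset.sum_neg_distrib]
        exact Finset.sum_congr rfl fun c _ => by rw [hF2 k i k c]; ring
      have := hScomm k i l k
      rw [h', ← hS i k l k]; linarith
    simp only [h, Finset.sum_add_distrib]
    rw [hSdiv, zero_add]
    congr 1
    rw [Finset.sum_comm]
    exact Finset.sum_congr rfl fun c _ => by rw [← Finset.mul_sum, hFric, hE i c]
  have e3 : ∑ k, F i k l k = E l i := by
    rw [← hE i l, ← hFric i l]
    exact Finset.sum_congr rfl fun k _ => by rw [hF1, hF2]; ring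
  have e4 : ∑ k, ∑ c, F i k l c * E c k = -∑ k, ∑ c, F k i l c * E c k := by
    simp only [← Finset.sum_neg_distrib]
    exact Finset.sum_congr rfl fun k _ => Finset.sum_congr rfl fun c _ => by rw [hF1]; ring
  -- Pair symmetry and the second Bianchi identity turn the divergence of the curvature into an
  -- antisymmetrized `∇Ric`; paired with `∇f`, one of its two terms is known from `hTv`.
  have e5 : ∑ k, ∑ c, W k i k l c * v c
      = ∑ c, v c * T c l i + ((1 / 2) * E l i - ∑ c, E l c * E c i) := by
    have hk : ∀ k c, W k i k l c = W c k l k i - W l k c k i := by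
      intro k c
      rw [pair_symm_of_bianchi (hW1 k) (hW2 k) (hW3 k) i k l c]
      have h1 := hW4 k c l k i
      have h2 := hW1 c l k k i
      linarith [hW1 l k c k i]
    have ht : ∑ k, ∑ c, W k i k l c * v c = ∑ c, v c * T c l i - ∑ c, T l i c * v c := by
      rw [Finset.sum_comm, ← Finset.sum_sub_distrib]
      refine Finset.sum_congr rfl fun c _ => ?_
      rw [← Finset.sum_mul, hT l i c, ← hWric c l i, ← hWric l c i, mul_comm (v c), ← sub_mul,
        ← Finset.sum_sub_distrib]
      congr 1
      exact Finset.sum_congr rfl fun k _ => hk k c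
    have hEE : ∑ c, E i c * E c l = ∑ c, E l c * E c i :=
      Finset.sum_congr rfl fun c _ => by rw [hE i c, hE c l]; ring
    rw [ht, hTv l i, hE i l, hEE]; ring
  rw [e2, e3, e4, e5] at e1
  linarith

/-- From `(b + c)² ≤ 2(b² + c²)` follows `3a² ≤ 2a`. -/
lemma nonneg_of_sum_eq_one {a b c : ℝ} (h1 : a + b + c = 1)
    (h2 : a ^ 2 + b ^ 2 + c ^ 2 = 1 / 2) : 0 ≤ a := by
  nlinarith [sq_nonneg (b - c), sq_nonneg a]

/-- Here `ab + bc + ca = 1/4`, hence `a³ + b³ + c³ - 1/4 = 3abc`. Substitute `hab`, `hac`, `hbc`.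
The terms in `s` cancel because `∑ ab(a+b) tc = ∑ c² tc`, by the cubic equation of the eigenvalues
and `ht`, `ht2`. The terms free of `f` and `s` are `3abc - 6abc ∑ (1-c)(1/2-c) = 0`. The coefficient
of `f` is `-3abc + 30abc = 27abc`, which is where the constant 9 comes from. -/
lemma drift_identity {a b c f s ta tb tc Kab Kac Kbc : ℝ} (h1 : a + b + c = 1)
    (h2 : a ^ 2 + b ^ 2 + c ^ 2 = 1 / 2) (ht : ta + tb + tc = 0)
    (ht2 : a * ta + b * tb + c * tc = 0)
    (hab : f * Kab = f * (1 / 2 - c) + c * (1 / 2 - c) + s * tc)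
    (hac : f * Kac = f * (1 / 2 - b) + b * (1 / 2 - b) + s * tb)
    (hbc : f * Kbc = f * (1 / 2 - a) + a * (1 / 2 - a) + s * ta) :
    9 * (f * (a ^ 3 + b ^ 3 + c ^ 3 - 1 / 4)) = (a ^ 3 + b ^ 3 + c ^ 3 - 1 / 4) * (1 - f)
      + 6 * s * (a ^ 2 * ta + b ^ 2 * tb + c ^ 2 * tc) + f * (3 * (a ^ 3 + b ^ 3 + c ^ 3)
      - 6 * (a * b * (a + b) * Kab + a * c * (a + c) * Kac + b * c * (b + c) * Kbc)) := by
  have hc : c = 1 - a - b := by linarith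
  have htc : tc = -ta - tb := by linarith
  subst hc htc
  grind
-- Drifted Laplacian of products and of `tr(Ric³)`
namespace MetricAlgebra

open Matrix
variable {R : Type*} [CommRing R] [Algebra ℝ R] (L : MetricAlgebra R)

lemma ginv_apply_symm (i j : Fin 4) : L.ginv i j = L.ginv j i := by
  conv_lhs => rw [← L.ginv_symm, Matrix.transpose_apply]

lemma gradInner_comm (u w : R) : L.gradInner u w = L.gradInner w u := by
  rw [gradInner, Finset.sum_comm]
  refine Finset.sum_congr rfl fun i _ => Finset.sum_congr rfl fun j _ => ?_
  rw [L.ginv_apply_symm j i]; ring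

lemma gradInner_eq (u w : R) : L.gradInner u w = ∑ i, L.grad u i 0 * L.d i w := by
  rw [gradInner_comm]
  simp only [gradInner, grad, Matrix.of_apply, Finset.sum_mul]
  exact Finset.sum_congr rfl fun i _ => Finset.sum_congr rfl fun j _ => by ring

lemma hess_mul (u w : R) (i j : Fin 4) : L.hess (u * w) i j
    = w * L.hess u i j + u * L.hess w i j + (L.d i u * L.d j w + L.d j u * L.d i w) := by
  simp only [hess, Matrix.of_apply, Derivation.leibniz, smul_eq_mul, map_add, mul_add, mul_sub,
    Finset.sum_add_distrib, Finset.mul_sum]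
  have h1 : ∀ x y : R, ∑ k, L.conn i k j * (x * L.d k y) = ∑ k, x * (L.conn i k j * L.d k y) :=
    fun x y => Finset.sum_congr rfl fun k _ => by ring
  rw [h1, h1]; ring

lemma trace_mul_eq (X Y : Matrix (Fin 4) (Fin 4) R) :
    (X * Y).trace = ∑ i, ∑ j, X i j * Y j i := by
  simp [Matrix.trace, Matrix.mul_apply]

lemma driftLap_mul (f u w : R) : L.driftLap f (u * w)
    = w * L.driftLap f u + 2 * L.gradInner u w + u * L.driftLap f w := by
  have h1 : L.gradInner f (u * w) = w * L.gradInner f u + u * L.gradInner f w := by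
    simp only [gradInner_eq, Finset.mul_sum, ← Finset.sum_add_distrib, Derivation.leibniz,
      smul_eq_mul]
    exact Finset.sum_congr rfl fun i _ => by ring
  have h2 : (L.ginv * L.hess (u * w)).trace = w * (L.ginv * L.hess u).trace
      + u * (L.ginv * L.hess w).trace + (L.gradInner u w + L.gradInner w u) := by
    simp only [trace_mul_eq, gradInner, Finset.mul_sum, ← Finset.sum_add_distrib]
    refine Finset.sum_congr rfl fun i _ => Finset.sum_congr rfl fun j _ => ?_
    rw [hess_mul]; ring
  rw [driftLap, h1, h2, L.gradInner_comm w u, driftLap, driftLap]; ring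

lemma hess_sub_algebraMap (u : R) (c : ℝ) : L.hess (u - algebraMap ℝ R c) = L.hess u := by
  ext i j; simp [hess]

lemma driftLap_sub_algebraMap (f u : R) (c : ℝ) :
    L.driftLap f (u - algebraMap ℝ R c) = L.driftLap f u := by
  simp [driftLap, hess_sub_algebraMap, gradInner]

lemma gradInner_sub_algebraMap (f u : R) (c : ℝ) :
    L.gradInner f (u - algebraMap ℝ R c) = L.gradInner f u := by
  simp [gradInner]

lemma d_trace_cube (j : Fin 4) :
    L.d j (L.ricE ^ 3).trace = 3 * (L.ricE * L.ricE * L.covRic j).trace := by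
  rw [d_trace, pow_succ, pow_two, cov_mul, cov_mul, Matrix.trace_add, add_mul, Matrix.trace_add,
    mul_assoc, Matrix.trace_mul_comm, mul_assoc L.ricE, Matrix.trace_mul_comm L.ricE, covRic,
    mul_assoc L.ricE (L.cov j L.ricE), Matrix.trace_mul_comm L.ricE (L.cov j L.ricE * L.ricE),
    mul_assoc (L.cov j L.ricE), Matrix.trace_mul_comm (L.cov j L.ricE)]
  ring

lemma hess_trace_cube (i j : Fin 4) : L.hess (L.ricE ^ 3).trace i j
    = 3 * ((L.covRic i * L.ricE * L.covRic j).trace + (L.ricE * L.covRic i * L.covRic j).trace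
      + (L.ricE * L.ricE * L.covRic2 i j).trace) := by
  have h : (L.ricE * L.ricE * L.covRic2 i j).trace = (L.ricE * L.ricE * L.cov i (L.covRic j)).trace
      - ∑ k, L.conn i k j * (L.ricE * L.ricE * L.covRic k).trace := by
    simp only [covRic2, mul_sub, Matrix.trace_sub, Finset.mul_sum, Matrix.trace_sum,
      Matrix.mul_smul, Matrix.trace_smul, smul_eq_mul]
  have h3 : L.d i (3 * (L.ricE * L.ricE * L.covRic j).trace)
      = 3 * L.d i (L.ricE * L.ricE * L.covRic j).trace := by
    have h0 : L.d i (3 : R) = 0 := by exact_mod_cast (L.d i).map_natCast 3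
    rw [Derivation.leibniz, h0, smul_zero, add_zero, smul_eq_mul]
  simp only [hess, Matrix.of_apply, d_trace_cube]
  rw [h, h3, d_trace, cov_mul, cov_mul, add_mul, Matrix.trace_add, Matrix.trace_add, mul_add,
    mul_add, mul_add, mul_add, mul_sub, Finset.mul_sum,
    Finset.sum_congr rfl fun k _ => mul_left_comm (L.conn i k j) 3 _]
  simp only [covRic]
  ring

/-- The trace of the soliton equation gives `Δf = 4/2 - S = 1`. -/
lemma IsSoliton.driftLap_self {f : R} (H : L.IsSoliton f) : L.driftLap f f = 1 - f := by
  rw [driftLap, H.norm, H.ginv_mul_hess, Matrix.trace_sub, H.scal, Matrix.trace_smul,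
    Matrix.trace_one]
  have : (1 / 2 : ℝ) • ((Fintype.card (Fin 4) : ℕ) : R) = 2 := by
    rw [← half_smul_two_mul (2 : R)]; norm_num
  rw [this]; ring

lemma covRic2_selfAdjoint {f : R} (H : L.IsSoliton f) (i j : Fin 4) :
    (L.covRic2 i j)ᵀ * L.g = L.g * L.covRic2 i j := by
  have h1 : ∀ k, (L.covRic k)ᵀ * L.g = L.g * L.covRic k := fun k =>
    L.cov_selfAdjoint k _ H.ricE_selfAdjoint
  simp only [covRic2, Matrix.transpose_sub, sub_mul, mul_sub, L.cov_selfAdjoint i _ (h1 j),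
    Matrix.transpose_sum, Matrix.transpose_smul, Finset.sum_mul, Finset.mul_sum, Matrix.smul_mul,
    Matrix.mul_smul, h1]

/-! ### The estimate at a point with an adapted orthonormal frame -/

section Point

variable {L} {f : R} (H : L.IsSoliton f) (ev : R →ₐ[ℝ] ℝ) (hg : L.g.map ev = 1)
include hg

lemma map_ginv_eq_one : L.ginv.map ev = 1 := by
  have h := congrArg (fun X => X.map ev) L.g_mul_ginv
  simpa [Matrix.map_mul, hg] using h

lemma symm_of_selfAdjoint {X : Matrix (Fin 4) (Fin 4) R} (hX : Xᵀ * L.g = L.g * X) (a b : Fin 4) :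
    ev (X a b) = ev (X b a) := by
  have h := congrArg (fun X => X.map ev) hX
  simp only [Matrix.map_mul, hg, mul_one, one_mul] at h
  exact (congrFun (congrFun h a) b).symm

lemma skew_of_skewAdjoint {X : Matrix (Fin 4) (Fin 4) R} (hX : Xᵀ * L.g = -(L.g * X))
    (a b : Fin 4) : ev (X a b) = -ev (X b a) := by
  have h := congrArg (fun X => X.map ev) hX
  have h2 : (-(L.g * X)).map ev = -(X.map ev) := by
    have hm : (L.g * X).map ev = X.map ev := by rw [Matrix.map_mul, hg, one_mul]
    rw [← hm]; ext a b; simp only [Matrix.map_apply, Matrix.neg_apply, map_neg]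
  simp only [Matrix.map_mul, hg, mul_one, h2] at h
  have := congrFun (congrFun h b) a
  simpa using this

include H

lemma laplace_ric (i l : Fin 4) :
    ∑ k, ev (L.covRic2 k k l i) - ∑ c, ev (L.grad f c 0) * ev (L.covRic c l i)
      = ev (L.ricE l i) + 2 * ∑ k, ∑ c, ev (L.curv k i l c) * ev (L.ricE c k) := by
  have hric : L.ric.map ev = L.ricE.map ev := by
    rw [← H.g_mul_ricE, Matrix.map_mul, hg, one_mul]
  have hneg : ∀ {X Y : Matrix (Fin 4) (Fin 4) R}, X = -Y → ∀ a b, ev (X a b) = -ev (Y a b) := by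
    rintro X Y rfl a b; simp
  refine laplace_ric_of_identities (E := fun a b => ev (L.ricE a b))
    (T := fun i a b => ev (L.covRic i a b)) (S := fun i j a b => ev (L.covRic2 i j a b))
    (F := fun i j a b => ev (L.curv i j a b)) (W := fun m i j a b => ev (L.covCurv m i j a b))
    (v := fun a => ev (L.grad f a 0))
    (symm_of_selfAdjoint ev hg H.ricE_selfAdjoint)
    (fun i => symm_of_selfAdjoint ev hg (L.cov_selfAdjoint i _ H.ricE_selfAdjoint))
    (fun i j => symm_of_selfAdjoint ev hg (L.covRic2_selfAdjoint H i j))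
    ?_ ?_ ?_ (fun i j => hneg (L.curv_antisymm i j))
    (fun i j => skew_of_skewAdjoint ev hg (L.curv_skew i j)) ?_
    (fun m i j => hneg (L.covCurv_antisymm m i j))
    (fun m i j => skew_of_skewAdjoint ev hg (L.covCurv_skew m i j)) ?_ ?_ ?_ ?_ i l
  · intro j k a b
    have h := congrArg ev (congrFun (congrFun (L.covRic2_comm j k) a) b)
    simpa [Matrix.mul_apply] using h
  · intro i j k a
    have h := congrArg ev (congrFun (congrFun (H.covRic2_mul_col i j k) a) 0)
    simpa [Matrix.mul_apply, col, sub_mul, mul_sub, Matrix.one_apply, Finset.sum_sub_distrib,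
      mul_comm] using h
  · intro i j
    simpa using congrArg ev (H.covRic2_div i j)
  · intro i j
    rw [show ev (L.ricE i j) = ev (L.ric i j) from (congrFun (congrFun hric i) j).symm]
    simp [ric]
  · intro m i j k a
    have h := congrArg ev (congrFun (congrFun (L.covCurv_bianchi_first m i j k) a) 0)
    simpa using h
  · intro i j k a b
    have h := congrArg ev (congrFun (congrFun (L.covCurv_bianchi i j k) a) b)
    simpa using h
  · intro m i j
    have h := congrArg ev (H.covCurv_trace m i j)
    rw [map_sum] at h
    rw [h]
    have h2 : (L.g * L.covRic m).map ev = (L.covRic m).map ev := by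
      rw [Matrix.map_mul, hg, one_mul]
    exact congrFun (congrFun h2 i) j
  · intro i a
    have h := congrArg ev (congrFun (congrFun (H.cov_mul_grad i) a) 0)
    rw [← mul_assoc, Matrix.neg_apply, mul_col_apply, mul_sub, Matrix.mul_smul, mul_one] at h
    simpa [Matrix.mul_apply, covRic] using h

omit H hg in
lemma ev_trace (X : Matrix (Fin 4) (Fin 4) R) : ev X.trace = (X.map ev).trace := by
  simp [Matrix.trace]

variable {lam : Fin 4 → ℝ} {s : ℝ} (hlam : L.ricE.map ev = Matrix.diagonal lam) (hs : 0 < s)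
  (hv : ∀ a, ev (L.grad f a 0) = if a = 0 then s else 0)
include hlam hs hv

/-- This is `cov_mul_grad` in the frame: as `∇f = s e₀`, the components of `∇Ric` with an index 0
are algebraic in `Ric`. -/
lemma ev_covRic_zero (k a : Fin 4) : ev (L.covRic k a 0) * s
    = -((1 / 2) * ev (L.ricE a k) - ev (L.ricE a k) * lam k) := by
  have h := congrArg ev (congrFun (congrFun (H.cov_mul_grad k) a) 0)
  rw [← mul_assoc, Matrix.neg_apply, mul_col_apply, mul_sub, Matrix.mul_smul, mul_one] at h
  have hE : ∀ c, ev (L.ricE c k) = if c = k then lam k else 0 := by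
    intro c
    have := congrFun (congrFun hlam c) k
    rw [Matrix.map_apply, Matrix.diagonal_apply] at this
    rw [this]; split_ifs with h
    · rw [h]
    · rfl
  simp only [Matrix.mul_apply, map_sum, map_mul, hv, mul_ite, mul_zero, Finset.sum_ite_eq',
    Finset.mem_univ, if_true, map_neg, Matrix.sub_apply, Matrix.smul_apply, map_sub, map_smul,
    smul_eq_mul, hE] at h
  simp only [covRic, hE]
  rw [h, mul_ite, mul_zero]

/-- The second conclusion, `h ≥ 0`, serves the critical points of `f`, which are reached by
continuity. -/
theorem drift_estimate_at :
    9 * (ev f * (∑ i, lam i ^ 3 - 1 / 4))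
      ≤ ev (L.driftLap f (f * ((L.ricE ^ 3).trace - algebraMap ℝ R (1 / 4))))
    ∧ 0 ≤ ∑ i, lam i ^ 3 - 1 / 4 := by
  have hEd : ∀ a b, ev (L.ricE a b) = if a = b then lam a else 0 := by
    intro a b
    have := congrFun (congrFun hlam a) b
    rwa [Matrix.map_apply, Matrix.diagonal_apply] at this
  have hginv := map_ginv_eq_one ev hg
  have hl0 : lam 0 = 0 := by
    have h := congrArg ev (congrFun (congrFun H.ricE_mul_grad 0) 0)
    simp only [Matrix.mul_apply, map_sum, map_mul, hEd, hv, ite_mul, zero_mul, Finset.sum_ite_eq,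
      Finset.mem_univ, if_true, Matrix.zero_apply, map_zero] at h
    exact (mul_eq_zero.mp h).resolve_right hs.ne'
  have hgv : ∀ a, ev (L.grad f a 0) = ev (L.d a f) := by
    intro a
    have h : (L.g * L.grad f).map ev = (L.diff f).map ev := by rw [L.g_mul_grad]
    rw [Matrix.map_mul, hg, one_mul] at h
    exact congrFun (congrFun h a) 0
  have hgrad : ∀ w, ev (L.gradInner f w) = s * ev (L.d 0 w) := by
    intro w
    simp only [gradInner_eq, map_sum, map_mul, hv, ite_mul, zero_mul, Finset.sum_ite_eq',
      Finset.mem_univ, if_true]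
  have hf : ev f = s ^ 2 := by
    rw [← H.norm, hgrad, ← hgv, hv, if_pos rfl, pow_two]
  have h1 : lam 1 + lam 2 + lam 3 = 1 := by
    have h := congrArg ev H.scal
    rw [ev_trace, hlam, Matrix.trace_diagonal, map_one, Fin.sum_univ_four, hl0] at h
    linarith
  have h2 : lam 1 ^ 2 + lam 2 ^ 2 + lam 3 ^ 2 = 1 / 2 := by
    have h := congrArg ev H.trace_sq
    rw [ev_trace, Matrix.map_mul, hlam, Matrix.diagonal_mul_diagonal, Matrix.trace_diagonal,
      Fin.sum_univ_four, hl0, AlgHom.commutes] at h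
    simp only [Algebra.algebraMap_self, RingHom.id_apply] at h
    linarith
  have hpos : ∀ i, 0 ≤ lam i := by
    intro i
    fin_cases i
    · exact hl0.ge
    · exact nonneg_of_sum_eq_one h1 h2
    · exact nonneg_of_sum_eq_one (a := lam 2) (b := lam 1) (c := lam 3) (by linarith)
        (by linarith)
    · exact nonneg_of_sum_eq_one (a := lam 3) (b := lam 1) (c := lam 2) (by linarith)
        (by linarith)
  -- Newton's identity with power sums 1 and 1/2.
  have hcube : ∑ i, lam i ^ 3 - 1 / 4 = 3 * (lam 1 * lam 2 * lam 3) := by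
    rw [Fin.sum_univ_four, hl0]
    have h3 : lam 3 = 1 - lam 1 - lam 2 := by linarith
    rw [h3] at h2 ⊢
    grind
  refine ⟨?_, by rw [hcube]; have := hpos 1; have := hpos 2; have := hpos 3; positivity⟩
  have hcube' : ev (L.ricE ^ 3).trace = ∑ i, lam i ^ 3 := by
    rw [ev_trace, pow_succ, pow_two, Matrix.map_mul, Matrix.map_mul, hlam,
      Matrix.diagonal_mul_diagonal, Matrix.diagonal_mul_diagonal, Matrix.trace_diagonal]
    exact Finset.sum_congr rfl fun i _ => by ring
  have htr : ∀ X, ev (L.ricE * L.ricE * X).trace = ∑ a, lam a ^ 2 * ev (X a a) := by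
    intro X
    rw [ev_trace, Matrix.map_mul, Matrix.map_mul, hlam, Matrix.diagonal_mul_diagonal]
    simp only [Matrix.trace, Matrix.diag_apply, Matrix.diagonal_mul, Matrix.map_apply, pow_two]
  have htr1 : ∀ X, ev (L.ricE * X).trace = ∑ a, lam a * ev (X a a) := by
    intro X
    rw [ev_trace, Matrix.map_mul, hlam]
    simp only [Matrix.trace, Matrix.diag_apply, Matrix.diagonal_mul, Matrix.map_apply]
  have htsymm : ∀ i a b, ev (L.covRic i a b) = ev (L.covRic i b a) := fun i =>
    symm_of_selfAdjoint ev hg (L.cov_selfAdjoint i _ H.ricE_selfAdjoint)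
  have ht0 := ev_covRic_zero H ev hg hlam hs hv
  have ht00 : ev (L.covRic 0 0 0) = 0 := by
    have h := ht0 0 0
    rw [hEd, if_pos rfl, hl0] at h
    exact (mul_eq_zero.mp (by linarith : ev (L.covRic 0 0 0) * s = 0)).resolve_right hs.ne'
  have htsum : ev (L.covRic 0 1 1) + ev (L.covRic 0 2 2) + ev (L.covRic 0 3 3) = 0 := by
    have h := congrArg ev (H.trace_cov 0)
    change ev (L.covRic 0).trace = _ at h
    rw [ev_trace] at h
    simp only [Matrix.trace, Matrix.diag_apply, Matrix.map_apply, Fin.sum_univ_four,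
      ht00, map_zero] at h
    linarith
  have htsum2 : lam 1 * ev (L.covRic 0 1 1) + lam 2 * ev (L.covRic 0 2 2)
      + lam 3 * ev (L.covRic 0 3 3) = 0 := by
    have h := congrArg ev (H.trace_mul_cov 0)
    change ev (2 * (L.ricE * L.covRic 0).trace) = _ at h
    rw [map_mul, htr1, Fin.sum_univ_four, hl0, map_ofNat, map_zero] at h
    linarith
  have hKanti : ∀ i j a b, ev (L.curv i j a b) = -ev (L.curv j i a b) := by
    intro i j a b
    rw [L.curv_antisymm i j, Matrix.neg_apply, map_neg]
  have hKskew : ∀ i j a b, ev (L.curv i j a b) = -ev (L.curv i j b a) := fun i j =>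
    skew_of_skewAdjoint ev hg (L.curv_skew i j)
  have hKsymm : ∀ i j, ev (L.curv i j i j) = ev (L.curv j i j i) := by
    intro i j; rw [hKanti, hKskew, neg_neg]
  have hKdiag : ∀ i, ev (L.curv i i i i) = 0 := by
    intro i; linarith [hKanti i i i i]
  have hric : ∀ a, ∑ k, ev (L.curv k a k a) = lam a := by
    intro a
    have h : L.ric.map ev = L.ricE.map ev := by
      rw [← H.g_mul_ricE, Matrix.map_mul, hg, one_mul]
    have h' := congrFun (congrFun h a) a
    rw [Matrix.map_apply, Matrix.map_apply, hEd, if_pos rfl] at h'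
    rw [← h', ric, Matrix.of_apply, map_sum]
  -- Radial sectional curvatures, multiplied by `f = s²` to avoid division: `curv_mul_grad` applied
  -- to `e₀, e_a`, with the `∇_a R_{a0}` term supplied by `ev_covRic_zero`.
  have hrad : ∀ a, a ≠ 0 → ev f * ev (L.curv 0 a 0 a)
      = lam a * (1 / 2 - lam a) + s * ev (L.covRic 0 a a) := by
    intro a ha
    have hC : L.curv 0 a * L.grad f = L.covRic a * col 0 - L.covRic 0 * col a :=
      H.curv_mul_grad 0 a
    have h := congrArg ev (congrFun (congrFun hC a) 0)
    simp only [Matrix.mul_apply (M := L.curv 0 a), map_sum, map_mul, hv, mul_ite, mul_zero,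
      Finset.sum_ite_eq', Finset.mem_univ, if_true, Matrix.sub_apply, mul_col_apply, map_sub] at h
    have h3 := ht0 a a
    rw [hEd, if_pos rfl] at h3
    rw [hf, hKskew]
    linear_combination (-s) * h - h3
  have hK := hric 1
  have hK2 := hric 2
  have hK3 := hric 3
  simp only [Fin.sum_univ_four, hKdiag, hKsymm 2 1, hKsymm 3 1, hKsymm 3 2] at hK hK2 hK3
  have hP1 := hrad 1 (by decide)
  have hP2 := hrad 2 (by decide)
  have hP3 := hrad 3 (by decide)
  -- The three equations `hK`, `hK2`, `hK3` are solved for the nonradial curvatures, e.g. `2 K₁₂ =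
  -- (λ₁ + λ₂ - λ₃) - (K₀₁ + K₀₂ - K₀₃)`; the multiples of `h1`, `h2`, `htsum` simplify the result
  -- by means of `∑ (λ_a (1/2 - λ_a) + s t_a) = 0`, where `t_a = ∇₀ R_aa`.
  have key := drift_identity (f := ev f) (s := s) h1 h2 htsum htsum2
    (Kab := ev (L.curv 1 2 1 2)) (Kac := ev (L.curv 1 3 1 3)) (Kbc := ev (L.curv 2 3 2 3))
    (by linear_combination (ev f / 2) * (hK + hK2 - hK3) - (1 / 2) * (hP1 + hP2 - hP3)
          + (ev f / 2 - 1 / 4) * h1 + (1 / 2) * h2 - (s / 2) * htsum)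
    (by linear_combination (ev f / 2) * (hK + hK3 - hK2) - (1 / 2) * (hP1 + hP3 - hP2)
          + (ev f / 2 - 1 / 4) * h1 + (1 / 2) * h2 - (s / 2) * htsum)
    (by linear_combination (ev f / 2) * (hK2 + hK3 - hK) - (1 / 2) * (hP2 + hP3 - hP1)
          + (ev f / 2 - 1 / 4) * h1 + (1 / 2) * h2 - (s / 2) * htsum)
  have hL : ∀ a, ∑ k, ev (L.covRic2 k k a a) - s * ev (L.covRic 0 a a)
      = lam a - 2 * ∑ k, lam k * ev (L.curv k a k a) := by
    intro a
    have h := laplace_ric H ev hg a a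
    simp only [hv, hEd, ite_mul, zero_mul, mul_ite, mul_zero, Finset.sum_ite_eq',
      Finset.mem_univ, if_true] at h
    rw [h, sub_eq_add_neg, ← mul_neg, ← Finset.sum_neg_distrib]
    congr 2
    exact Finset.sum_congr rfl fun k _ => by rw [hKskew]; ring
  -- The gradient term discarded in the estimate; its sign needs the nonnegativity of the
  -- eigenvalues.
  have hG : 0 ≤ ∑ i, ∑ a, lam a * ∑ b, ev (L.covRic i a b) ^ 2 :=
    Finset.sum_nonneg fun i _ => Finset.sum_nonneg fun a _ =>
      mul_nonneg (hpos a) (Finset.sum_nonneg fun b _ => sq_nonneg _)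
  have hcov : ∀ i, ev (L.ricE * L.covRic i * L.covRic i).trace
      = ∑ a, lam a * ∑ b, ev (L.covRic i a b) ^ 2 := by
    intro i
    rw [mul_assoc, htr1]
    refine Finset.sum_congr rfl fun a _ => ?_
    rw [Matrix.mul_apply, map_sum]
    congr 1
    exact Finset.sum_congr rfl fun b _ => by rw [map_mul, htsymm i b a, pow_two]
  have hcov' : ∀ i, ev (L.covRic i * L.ricE * L.covRic i).trace
      = ∑ a, lam a * ∑ b, ev (L.covRic i a b) ^ 2 := by
    intro i; rw [← hcov, Matrix.trace_mul_cycle, Matrix.trace_mul_cycle, mul_assoc]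
  have hdh : ev (L.d 0 (L.ricE ^ 3).trace) = 3 * ∑ a, lam a ^ 2 * ev (L.covRic 0 a a) := by
    rw [d_trace_cube, map_mul, htr, map_ofNat]
  have hlap : ev (L.driftLap f (L.ricE ^ 3).trace)
      = 6 * (∑ i, ∑ a, lam a * ∑ b, ev (L.covRic i a b) ^ 2)
        + 3 * ∑ a, lam a ^ 2 * (lam a - 2 * ∑ k, lam k * ev (L.curv k a k a)) := by
    have h3 : ev (L.ginv * L.hess (L.ricE ^ 3).trace).trace
        = ∑ i, ev (L.hess (L.ricE ^ 3).trace i i) := by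
      rw [ev_trace, Matrix.map_mul, hginv, one_mul]; rfl
    rw [driftLap, map_sub, h3, hgrad, hdh]
    have e : ∑ a, lam a ^ 2 * (lam a - 2 * ∑ k, lam k * ev (L.curv k a k a))
        = ∑ i, ∑ a, lam a ^ 2 * ev (L.covRic2 i i a a)
          - s * ∑ a, lam a ^ 2 * ev (L.covRic 0 a a) := by
      rw [Finset.sum_congr rfl fun a _ => by rw [← hL a]]
      simp only [mul_sub, Finset.sum_sub_distrib, Finset.mul_sum]
      rw [Finset.sum_comm]
      congr 1
      exact Finset.sum_congr rfl fun a _ => by ring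
    rw [e]
    simp only [hess_trace_cube, map_mul, map_add, hcov, hcov', htr, map_ofNat, ← Finset.mul_sum,
      Finset.sum_add_distrib]
    ring
  rw [driftLap_mul, H.driftLap_self, driftLap_sub_algebraMap, gradInner_sub_algebraMap]
  simp only [map_add, map_mul, map_sub, map_one, AlgHom.commutes, hcube', hgrad, hdh, hlap,
    map_ofNat, Algebra.algebraMap_self, RingHom.id_apply]
  simp only [Fin.sum_univ_four (fun a => lam a ^ 2 * _), Fin.sum_univ_four (fun a => lam a ^ 3),
    Fin.sum_univ_four (fun a => lam a * ev _), hKdiag, hKsymm 2 1, hKsymm 3 1, hKsymm 3 2, hl0]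
  have hfG := mul_nonneg (by rw [hf]; positivity : 0 ≤ ev f) hG
  linear_combination key + 6 * hfG

end Point

/-! ### Invariance under constant linear changes of coordinates -/

/-- The Levi-Civita connection is the only torsion free metric connection. -/
lemma conn_unique {A : Fin 4 → Matrix (Fin 4) (Fin 4) R}
    (hA : ∀ i, mapD (L.d i) L.g = (A i)ᵀ * L.g + L.g * A i) (hs : ∀ i k l, A i l k = A k l i)
    (i : Fin 4) : L.conn i = A i := by
  apply L.mul_left_cancel_g
  rw [g_mul_conn]
  have hB : ∀ i k l, (L.g * A i) l k = (L.g * A k) l i := by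
    intro i k l
    simp only [Matrix.mul_apply]
    exact Finset.sum_congr rfl fun m _ => by rw [hs i k m]
  have hd : ∀ i k l, L.d i (L.g k l) = (L.g * A i) l k + (L.g * A i) k l := by
    intro i k l
    have h := congrFun (congrFun (hA i) k) l
    rw [← L.g_symm, ← Matrix.transpose_mul, L.g_symm] at h
    exact h
  ext l k
  simp only [Matrix.smul_apply, chr, Matrix.of_apply, hd]
  have e : (L.g * A i) l k + (L.g * A i) k l + ((L.g * A k) l i + (L.g * A k) i l)
      - ((L.g * A l) k i + (L.g * A l) i k) = 2 * (L.g * A i) l k := by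
    rw [hB k i l, hB k l i, hB l i k]; ring
  rw [e, half_smul_two_mul]

/-- A real matrix viewed as a constant matrix over the algebra of functions. -/
abbrev constMat (R : Type*) [CommRing R] [Algebra ℝ R] (P : Matrix (Fin 4) (Fin 4) ℝ) :
    Matrix (Fin 4) (Fin 4) R := P.map (algebraMap ℝ R)

lemma constMat_apply (P : Matrix (Fin 4) (Fin 4) ℝ) (a b : Fin 4) :
    constMat R P a b = algebraMap ℝ R (P a b) := rfl

lemma derivation_sum_apply (D : Fin 4 → Derivation ℝ R R) (c : Fin 4 → ℝ) (u : R) :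
    (∑ i, c i • D i) u = ∑ i, c i • D i u := by
  simp [Fin.sum_univ_four]

lemma mapD_constMat (D : Derivation ℝ R R) (P : Matrix (Fin 4) (Fin 4) ℝ) :
    mapD D (constMat R P) = 0 := by ext; simp

lemma constMat_mul_eq_one {P Q : Matrix (Fin 4) (Fin 4) ℝ} (h : P * Q = 1) :
    constMat R P * constMat R Q = 1 := by
  rw [← Matrix.map_mul, h]; simp

section Change

variable (P Q : Matrix (Fin 4) (Fin 4) ℝ) (hPQ : P * Q = 1)

/-- A linear change of coordinates. -/
def change : MetricAlgebra R where
  d a := ∑ i, P i a • L.d i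
  d_comm a b u := by
    simp only [derivation_sum_apply, map_sum, Derivation.map_smul, Finset.smul_sum]
    rw [Finset.sum_comm]
    exact Finset.sum_congr rfl fun i _ => Finset.sum_congr rfl fun j _ => by
      rw [L.d_comm, smul_comm]
  g := (constMat R P)ᵀ * L.g * constMat R P
  ginv := constMat R Q * L.ginv * (constMat R Q)ᵀ
  g_mul_ginv := by
    have h1 := constMat_mul_eq_one (R := R) hPQ
    have h2 : (constMat R P)ᵀ * (constMat R Q)ᵀ = 1 := by
      rw [← Matrix.transpose_mul, constMat_mul_eq_one (mul_eq_one_comm.mp hPQ),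
        Matrix.transpose_one]
    calc _ = (constMat R P)ᵀ * (L.g * ((constMat R P * constMat R Q) * L.ginv))
        * (constMat R Q)ᵀ := by noncomm_ring
      _ = 1 := by rw [h1, one_mul, L.g_mul_ginv, mul_one, h2]
  g_symm := by
    rw [Matrix.transpose_mul, Matrix.transpose_mul, L.g_symm, Matrix.transpose_transpose,
      mul_assoc]

lemma mapD_change (a : Fin 4) (X : Matrix (Fin 4) (Fin 4) R) :
    mapD ((L.change P Q hPQ).d a) X = ∑ i, P i a • mapD (L.d i) X := by
  ext k l
  simp [change, derivation_sum_apply, Matrix.sum_apply]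

lemma change_d_apply (a : Fin 4) (u : R) :
    (L.change P Q hPQ).d a u = ∑ i, P i a • L.d i u := by
  simp [change, derivation_sum_apply]

include hPQ in
lemma constMat_cancel (X : Matrix (Fin 4) (Fin 4) R) :
    constMat R P * (constMat R Q * X) = X := by
  rw [← mul_assoc, constMat_mul_eq_one hPQ, one_mul]

include hPQ in
lemma constMat_cancel_transpose' (X : Matrix (Fin 4) (Fin 4) R) :
    (constMat R Q)ᵀ * ((constMat R P)ᵀ * X) = X := by
  rw [← mul_assoc, ← Matrix.transpose_mul, constMat_mul_eq_one hPQ,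
    Matrix.transpose_one, one_mul]

lemma mapD_conj (D : Derivation ℝ R R) (X : Matrix (Fin 4) (Fin 4) R) :
    mapD D (constMat R Q * X * constMat R P) = constMat R Q * mapD D X * constMat R P := by
  rw [mapD_mul, mapD_mul, mapD_constMat, mapD_constMat]; simp

/-- As `P` is constant, there is no inhomogeneous term; the conjugated connection is metric and
torsion free, so `conn_unique` identifies it without computing Christoffel symbols. -/
lemma change_conn (a : Fin 4) : (L.change P Q hPQ).conn a
    = ∑ i, P i a • (constMat R Q * L.conn i * constMat R P) := by
  refine (L.change P Q hPQ).conn_unique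
    (A := fun a => ∑ i, P i a • (constMat R Q * L.conn i * constMat R P)) ?_ ?_ a
  · intro a
    rw [mapD_change]
    have hg : (L.change P Q hPQ).g = (constMat R P)ᵀ * L.g * constMat R P := rfl
    rw [hg, Matrix.transpose_sum, Finset.sum_mul, Finset.mul_sum, ← Finset.sum_add_distrib]
    refine Finset.sum_congr rfl fun i _ => ?_
    rw [mapD_mul, mapD_mul, mapD_transpose, mapD_constMat, Matrix.transpose_zero, mapD_g,
      Matrix.transpose_smul, Matrix.smul_mul, Matrix.mul_smul, ← smul_add]
    congr 1
    simp only [Matrix.transpose_mul, mul_assoc, constMat_cancel P Q hPQ,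
      constMat_cancel_transpose' P Q hPQ, zero_mul, mul_zero, add_zero, zero_add, mul_add, add_mul]
  · intro a k l
    simp only [Matrix.sum_apply, Matrix.smul_apply]
    have h : ∀ a k, ∑ i, P i a • (constMat R Q * L.conn i * constMat R P) l k
        = ∑ i, ∑ m, algebraMap ℝ R (P i a) * (algebraMap ℝ R (P m k)
          * (constMat R Q * L.conn i) l m) := by
      intro a k
      refine Finset.sum_congr rfl fun i _ => ?_
      rw [Matrix.mul_apply, Algebra.smul_def, Finset.mul_sum]
      exact Finset.sum_congr rfl fun m _ => by rw [constMat_apply]; ring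
    rw [h, h, Finset.sum_comm]
    refine Finset.sum_congr rfl fun i _ => Finset.sum_congr rfl fun m _ => ?_
    have : (constMat R Q * L.conn m) l i = (constMat R Q * L.conn i) l m := by
      simp only [Matrix.mul_apply]
      exact Finset.sum_congr rfl fun p _ => by rw [L.conn_symm m i p]
    rw [this]; ring

lemma change_curv (a b : Fin 4) : (L.change P Q hPQ).curv a b
    = ∑ i, ∑ j, (P i a * P j b) • (constMat R Q * L.curv i j * constMat R P) := by
  have hm : ∀ a b, mapD ((L.change P Q hPQ).d a) ((L.change P Q hPQ).conn b) = ∑ i, ∑ j,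
      (P i a * P j b) • (constMat R Q * mapD (L.d i) (L.conn j) * constMat R P) := by
    intro a b
    rw [mapD_change]
    refine Finset.sum_congr rfl fun i _ => ?_
    rw [change_conn]
    have : mapD (L.d i) (∑ j, P j b • (constMat R Q * L.conn j * constMat R P))
        = ∑ j, P j b • (constMat R Q * mapD (L.d i) (L.conn j) * constMat R P) := by
      simp only [← mapD_conj]
      ext k l; simp only [mapD_apply, Matrix.sum_apply, map_sum, Matrix.smul_apply,
        Derivation.map_smul]
    rw [this, Finset.smul_sum]
    exact Finset.sum_congr rfl fun j _ => by rw [smul_smul]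
  have hc : ∀ a b, (L.change P Q hPQ).conn a * (L.change P Q hPQ).conn b = ∑ i, ∑ j,
      (P i a * P j b) • (constMat R Q * (L.conn i * L.conn j) * constMat R P) := by
    intro a b
    rw [change_conn, change_conn, Finset.sum_mul]
    refine Finset.sum_congr rfl fun i _ => ?_
    rw [Finset.mul_sum]
    refine Finset.sum_congr rfl fun j _ => ?_
    rw [Matrix.smul_mul, Matrix.mul_smul, smul_smul]
    simp only [mul_assoc, constMat_cancel P Q hPQ]
  have hswap : ∀ X : Fin 4 → Fin 4 → Matrix (Fin 4) (Fin 4) R,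
      ∑ i, ∑ j, (P i b * P j a) • X i j = ∑ i, ∑ j, (P i a * P j b) • X j i := by
    intro X
    rw [Finset.sum_comm]
    exact Finset.sum_congr rfl fun i _ => Finset.sum_congr rfl fun j _ => by rw [mul_comm]
  rw [curv, hm, hm, hc, hc, hswap, hswap]
  simp only [← Finset.sum_sub_distrib, ← Finset.sum_add_distrib, ← smul_sub, ← smul_add]
  refine Finset.sum_congr rfl fun i _ => Finset.sum_congr rfl fun j _ => ?_
  congr 1
  rw [curv]; noncomm_ring

lemma change_ric : (L.change P Q hPQ).ric = (constMat R P)ᵀ * L.ric * constMat R P := by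
  ext a b
  have h : ∀ i j, ∑ c, algebraMap ℝ R (P i c) * (constMat R Q * L.curv i j * constMat R P) c b
      = (L.curv i j * constMat R P) i b := by
    intro i j
    rw [← constMat_cancel P Q hPQ (L.curv i j * constMat R P), ← mul_assoc (constMat R Q)]
    rfl
  have e : (L.change P Q hPQ).ric a b = ∑ i, ∑ j, algebraMap ℝ R (P j a)
      * (L.curv i j * constMat R P) i b := by
    simp only [ric, Matrix.of_apply, change_curv, Matrix.sum_apply, Matrix.smul_apply, ← h,
      Finset.mul_sum]
    rw [Finset.sum_comm]
    refine Finset.sum_congr rfl fun i _ => ?_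
    rw [Finset.sum_comm]
    exact Finset.sum_congr rfl fun j _ => Finset.sum_congr rfl fun c _ => by
      rw [Algebra.smul_def, map_mul]; ring
  rw [e, Finset.sum_comm, mul_assoc, Matrix.mul_apply]
  refine Finset.sum_congr rfl fun j _ => ?_
  rw [← Finset.mul_sum, Matrix.transpose_apply, constMat_apply]
  congr 1
  simp only [Matrix.mul_apply, ric, Matrix.of_apply, Finset.sum_mul]
  rw [Finset.sum_comm]

lemma change_ricE : (L.change P Q hPQ).ricE = constMat R Q * L.ricE * constMat R P := by
  have h : (L.change P Q hPQ).ginv = constMat R Q * L.ginv * (constMat R Q)ᵀ := rfl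
  rw [ricE, h, change_ric, ricE]
  simp only [mul_assoc, constMat_cancel_transpose' P Q hPQ]

lemma change_diff (u : R) : (L.change P Q hPQ).diff u = (constMat R P)ᵀ * L.diff u := by
  ext a b
  simp [diff, change_d_apply, Matrix.mul_apply, Algebra.smul_def]

lemma hess_apply (u : R) (a b : Fin 4) :
    L.hess u a b = (mapD (L.d a) (L.diff u) - (L.conn a)ᵀ * L.diff u) b 0 := by
  simp [hess, diff, Matrix.mul_apply]

lemma change_hess (u : R) :
    (L.change P Q hPQ).hess u = (constMat R P)ᵀ * L.hess u * constMat R P := by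
  ext a b
  have e : mapD ((L.change P Q hPQ).d a) ((L.change P Q hPQ).diff u)
      - ((L.change P Q hPQ).conn a)ᵀ * (L.change P Q hPQ).diff u = ∑ i, P i a •
        ((constMat R P)ᵀ * (mapD (L.d i) (L.diff u) - (L.conn i)ᵀ * L.diff u)) := by
    rw [mapD_change, change_conn, change_diff, Matrix.transpose_sum, Finset.sum_mul,
      ← Finset.sum_sub_distrib]
    refine Finset.sum_congr rfl fun i _ => ?_
    rw [mapD_mul, mapD_transpose, mapD_constMat, Matrix.transpose_zero, zero_mul, zero_add,
      Matrix.transpose_smul, Matrix.smul_mul, ← smul_sub]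
    simp only [Matrix.transpose_mul, mul_assoc, constMat_cancel_transpose' P Q hPQ, mul_sub]
  rw [hess_apply, e, Matrix.sum_apply, mul_assoc, Matrix.mul_apply]
  refine Finset.sum_congr rfl fun i _ => ?_
  rw [Matrix.smul_apply, Algebra.smul_def, Matrix.transpose_apply, constMat_apply]
  congr 1
  rw [Matrix.mul_apply, Matrix.mul_apply]
  refine Finset.sum_congr rfl fun j _ => ?_
  rw [← hess_apply, Matrix.transpose_apply, mul_comm]

lemma change_grad (u : R) : (L.change P Q hPQ).grad u = constMat R Q * L.grad u := by
  have h : (L.change P Q hPQ).ginv = constMat R Q * L.ginv * (constMat R Q)ᵀ := rfl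
  rw [grad_eq, grad_eq, h, change_diff]
  simp only [mul_assoc, constMat_cancel_transpose' P Q hPQ]

lemma gradInner_eq_apply (u w : R) : L.gradInner u w = ((L.grad u)ᵀ * L.diff w) 0 0 := by
  rw [gradInner_eq]; simp [Matrix.mul_apply, diff]

lemma change_gradInner (u w : R) : (L.change P Q hPQ).gradInner u w = L.gradInner u w := by
  rw [gradInner_eq_apply, gradInner_eq_apply, change_grad, change_diff]
  simp only [Matrix.transpose_mul, mul_assoc, constMat_cancel_transpose' P Q hPQ]

lemma change_driftLap (f u : R) : (L.change P Q hPQ).driftLap f u = L.driftLap f u := by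
  have h : (L.change P Q hPQ).ginv = constMat R Q * L.ginv * (constMat R Q)ᵀ := rfl
  rw [driftLap, driftLap, change_gradInner, change_hess, h]
  congr 1
  simp only [mul_assoc, constMat_cancel_transpose' P Q hPQ]
  rw [Matrix.trace_mul_comm]
  simp only [mul_assoc, constMat_mul_eq_one hPQ, mul_one]

lemma change_trace_ricE_cube :
    ((L.change P Q hPQ).ricE ^ 3).trace = (L.ricE ^ 3).trace := by
  rw [change_ricE, pow_succ, pow_two]
  simp only [mul_assoc, constMat_cancel P Q hPQ]
  rw [Matrix.trace_mul_comm]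
  simp only [mul_assoc, constMat_mul_eq_one hPQ, mul_one]
  rw [pow_succ, pow_two, mul_assoc]

lemma IsSoliton.change {f : R} (H : L.IsSoliton f) : (L.change P Q hPQ).IsSoliton f where
  eq := by
    have h : (L.change P Q hPQ).g = (constMat R P)ᵀ * L.g * constMat R P := rfl
    rw [change_ric, change_hess, ← add_mul, ← mul_add, H.eq, h, Matrix.mul_smul, Matrix.smul_mul]
  norm := by rw [change_gradInner, H.norm]
  scal := by
    rw [change_ricE, Matrix.trace_mul_comm, ← mul_assoc, constMat_mul_eq_one hPQ, one_mul, H.scal]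

end Change

/-- Simultaneous normal form of a metric, a self-adjoint endomorphism and a null vector of it. -/
def HasAdaptedFrame (g E : Matrix (Fin 4) (Fin 4) ℝ) (v : Fin 4 → ℝ) : Prop :=
  ∃ (P Q : Matrix (Fin 4) (Fin 4) ℝ) (lam : Fin 4 → ℝ) (s : ℝ), P * Q = 1 ∧ Pᵀ * g * P = 1 ∧
    Q * E * P = Matrix.diagonal lam ∧ 0 < s ∧ ∀ a, (Q *ᵥ v) a = if a = 0 then s else 0

/-- Both sides are invariant under `change`, and the frame need only be orthonormal at the single
point of evaluation, so a constant change of coordinates suffices. -/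
theorem drift_estimate {f : R} (H : L.IsSoliton f) (ev : R →ₐ[ℝ] ℝ)
    (hfr : HasAdaptedFrame (L.g.map ev) (L.ricE.map ev) (fun a => ev (L.grad f a 0))) :
    9 * (ev f * ev ((L.ricE ^ 3).trace - algebraMap ℝ R (1 / 4)))
      ≤ ev (L.driftLap f (f * ((L.ricE ^ 3).trace - algebraMap ℝ R (1 / 4))))
    ∧ 0 ≤ ev ((L.ricE ^ 3).trace - algebraMap ℝ R (1 / 4)) := by
  obtain ⟨P, Q, lam, s, hPQ, hg, hE, hs, hv⟩ := hfr
  have hc : ∀ X : Matrix (Fin 4) (Fin 4) ℝ, (constMat R X).map ev = X := by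
    intro X; ext a b; simp
  have hE' : (L.change P Q hPQ).ricE.map ev = Matrix.diagonal lam := by
    rw [change_ricE, Matrix.map_mul, Matrix.map_mul, hc, hc, hE]
  have h := drift_estimate_at (L := L.change P Q hPQ) (H.change L P Q hPQ) ev (lam := lam) (s := s)
    (by
      have h : (L.change P Q hPQ).g = (constMat R P)ᵀ * L.g * constMat R P := rfl
      rw [h, Matrix.map_mul, Matrix.map_mul, Matrix.transpose_map, hc, hg])
    hE' hs
    (by
      intro a
      rw [← hv a, change_grad]
      simp [Matrix.mul_apply, Matrix.mulVec, dotProduct])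
  have ht : ev (L.ricE ^ 3).trace = ∑ i, lam i ^ 3 := by
    rw [← L.change_trace_ricE_cube P Q hPQ, ev_trace, pow_succ, pow_two, Matrix.map_mul,
      Matrix.map_mul, hE', Matrix.diagonal_mul_diagonal, Matrix.diagonal_mul_diagonal,
      Matrix.trace_diagonal]
    exact Finset.sum_congr rfl fun i _ => by ring
  rw [change_driftLap, change_trace_ricE_cube] at h
  rw [map_sub, ht, AlgHom.commutes]
  exact h

/-! ### Existence of the adapted frame -/

open scoped MatrixOrder Matrix.Norms.L2Operator

/-- A symmetric matrix with a null vector has an orthonormal eigenbasis containing a positive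
multiple of it. -/
lemma exists_orthogonal_diagonalization (H : Matrix (Fin 4) (Fin 4) ℝ) (hH : Hᵀ = H)
    (w : Fin 4 → ℝ) (hw : w ≠ 0) (hHw : H *ᵥ w = 0) :
    ∃ (U : Matrix (Fin 4) (Fin 4) ℝ) (lam : Fin 4 → ℝ) (s : ℝ), Uᵀ * U = 1 ∧
      H * U = U * Matrix.diagonal lam ∧ 0 < s ∧ ∀ a, (Uᵀ *ᵥ w) a = if a = 0 then s else 0 := by
  set T : EuclideanSpace ℝ (Fin 4) →ₗ[ℝ] EuclideanSpace ℝ (Fin 4) := Matrix.toEuclideanLin H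
  have hT : T.IsSymmetric := Matrix.isSymmetric_toEuclideanLin_iff.mpr (by
    rw [Matrix.IsHermitian, Matrix.conjTranspose_eq_transpose_of_trivial, hH])
  set w' : EuclideanSpace ℝ (Fin 4) := WithLp.toLp 2 w with hw'
  have hw0 : w' ≠ 0 := by
    intro h; apply hw; ext i; exact congrArg (fun z : EuclideanSpace ℝ (Fin 4) => z i) h
  have hTw : T w' = 0 := by
    ext i; simpa [T, w', Matrix.toLpLin_apply] using congrFun hHw i
  have : Fact (Module.finrank ℝ (EuclideanSpace ℝ (Fin 4)) = 3 + 1) := ⟨by simp⟩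
  -- The spectral theorem is applied on the complement of `w`, invariant because `T` is symmetric
  -- and `T w = 0`; the direction of `w` can then be the first basis vector even when the kernel is
  -- larger than its span.
  set K := (Submodule.span ℝ {w'})ᗮ with hK
  have hinv : ∀ v ∈ K, T v ∈ K := by
    intro v hv
    rw [hK, Submodule.mem_orthogonal_singleton_iff_inner_right] at hv ⊢
    rw [← hT, hTw, inner_zero_left]
  have hn : Module.finrank ℝ K = 3 := Submodule.finrank_orthogonal_span_singleton hw0
  have hTK : (T.restrict hinv).IsSymmetric := hT.restrict_invariant hinv
  set b := hTK.eigenvectorBasis hn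
  set mu := hTK.eigenvalues hn
  have hb : ∀ i, T (b i : EuclideanSpace ℝ (Fin 4)) = mu i • (b i : EuclideanSpace ℝ (Fin 4)) := by
    intro i
    have h := hTK.apply_eigenvectorBasis hn i
    exact congrArg Subtype.val h
  have hbo : ∀ i j, inner ℝ (b i : EuclideanSpace ℝ (Fin 4)) (b j : EuclideanSpace ℝ (Fin 4))
      = if i = j then (1 : ℝ) else 0 := by
    intro i j
    exact (orthonormal_iff_ite.mp b.orthonormal) i j
  have hbw : ∀ i, inner ℝ w' (b i : EuclideanSpace ℝ (Fin 4)) = 0 := by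
    intro i
    exact Submodule.mem_orthogonal_singleton_iff_inner_right.mp (b i).2
  have hbw' : ∀ i, inner ℝ (b i : EuclideanSpace ℝ (Fin 4)) w' = 0 := by
    intro i; rw [real_inner_comm, hbw]
  have hnw : 0 < ‖w'‖ := norm_pos_iff.mpr hw0
  set u : Fin 4 → EuclideanSpace ℝ (Fin 4) :=
    Fin.cons (‖w'‖⁻¹ • w') (fun i => (b i : EuclideanSpace ℝ (Fin 4))) with hu
  set lam : Fin 4 → ℝ := Fin.cons 0 mu with hlam
  have huo : ∀ i j, inner ℝ (u i) (u j) = if i = j then (1 : ℝ) else 0 := by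
    intro i j
    refine Fin.cases ?_ (fun i => ?_) i <;> refine Fin.cases ?_ (fun j => ?_) j
    · simp only [hu, Fin.cons_zero, real_inner_self_eq_norm_sq, if_true, norm_smul, norm_inv,
        norm_norm]
      field_simp
    · simp [hu, real_inner_smul_left, hbw, (Fin.succ_ne_zero j).symm]
    · simp [hu, real_inner_smul_right, hbw']
    · simp [hu, hbo]
  have huT : ∀ i, T (u i) = lam i • u i := by
    intro i
    refine Fin.cases ?_ (fun i => ?_) i
    · simp [hu, hlam, hTw]
    · simp [hu, hlam, hb]
  have huw : ∀ i, inner ℝ (u i) w' = if i = 0 then ‖w'‖ else 0 := by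
    intro i
    refine Fin.cases ?_ (fun i => ?_) i
    · simp only [hu, Fin.cons_zero, real_inner_smul_left, real_inner_self_eq_norm_sq, if_true]
      field_simp
    · simp [hu, hbw']
  have hin : ∀ x y : EuclideanSpace ℝ (Fin 4), inner ℝ x y = ∑ i, x i * y i := by
    intro x y
    simp [PiLp.inner_apply, mul_comm]
  refine ⟨Matrix.of fun i j => u j i, lam, ‖w'‖, ?_, ?_, hnw, ?_⟩
  · ext i j
    rw [Matrix.one_apply, ← huo, hin]
    simp [Matrix.mul_apply]
  · ext i j
    have h := congrArg (fun z : EuclideanSpace ℝ (Fin 4) => z i) (huT j)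
    simp only [T, Matrix.toLpLin_apply, PiLp.smul_apply, smul_eq_mul] at h
    rw [Matrix.mul_diagonal, Matrix.of_apply, mul_comm, ← h]
    simp [Matrix.mul_apply, Matrix.mulVec, dotProduct]
  · intro a
    rw [← huw, hin]
    simp [Matrix.mulVec, dotProduct, w']

/-- With `g = BᵀB`, the matrix `B E B⁻¹` is symmetric; if an orthogonal `U` diagonalizes it, the
frame is `P = B⁻¹U`. -/
lemma hasAdaptedFrame {g E : Matrix (Fin 4) (Fin 4) ℝ} {v : Fin 4 → ℝ} (hg : g.PosDef)
    (hE : Eᵀ * g = g * E) (hEv : E *ᵥ v = 0) (hv : v ≠ 0) : HasAdaptedFrame g E v := by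
  obtain ⟨B, hB⟩ : ∃ B : Matrix (Fin 4) (Fin 4) ℝ, g = Bᵀ * B := by
    obtain ⟨B, hB⟩ := CStarAlgebra.nonneg_iff_eq_star_mul_self.mp hg.posSemidef.nonneg
    exact ⟨B,
        by rw [hB, Matrix.star_eq_conjTranspose, Matrix.conjTranspose_eq_transpose_of_trivial]⟩
  have hdet : IsUnit B.det := by
    have h := hg.det_pos
    rw [hB, Matrix.det_mul, Matrix.det_transpose] at h
    exact isUnit_iff_ne_zero.mpr fun h0 => by simp [h0] at h
  have h1 : B * B⁻¹ = 1 := Matrix.mul_nonsing_inv B hdet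
  have h2 : B⁻¹ * B = 1 := Matrix.nonsing_inv_mul B hdet
  have h3 : B⁻¹ᵀ * Bᵀ = 1 := by rw [← Matrix.transpose_mul, h1, Matrix.transpose_one]
  have hsym : (B * E * B⁻¹)ᵀ = B * E * B⁻¹ := by
    rw [hB] at hE
    calc (B * E * B⁻¹)ᵀ = B⁻¹ᵀ * (Eᵀ * (Bᵀ * (B * B⁻¹))) := by
          rw [h1, mul_one, Matrix.transpose_mul, Matrix.transpose_mul]
      _ = B⁻¹ᵀ * (Eᵀ * (Bᵀ * B)) * B⁻¹ := by noncomm_ring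
      _ = B⁻¹ᵀ * Bᵀ * (B * E * B⁻¹) := by rw [hE]; noncomm_ring
      _ = B * E * B⁻¹ := by rw [h3, one_mul]
  obtain ⟨U, lam, s, hU, hHU, hs, hUw⟩ := exists_orthogonal_diagonalization (B * E * B⁻¹) hsym
    (B *ᵥ v)
    (by
      intro h
      apply hv
      have := congrArg (B⁻¹ *ᵥ ·) h
      simpa [Matrix.mulVec_mulVec, h2] using this)
    (by rw [Matrix.mulVec_mulVec, mul_assoc, h2, mul_one, ← Matrix.mulVec_mulVec, hEv,
      Matrix.mulVec_zero])
  have hU' : U * Uᵀ = 1 := mul_eq_one_comm.mp hU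
  refine ⟨B⁻¹ * U, Uᵀ * B, lam, s, ?_, ?_, ?_, hs, ?_⟩
  · calc B⁻¹ * U * (Uᵀ * B) = B⁻¹ * (U * Uᵀ) * B := by noncomm_ring
      _ = 1 := by rw [hU', mul_one, h2]
  · calc (B⁻¹ * U)ᵀ * g * (B⁻¹ * U) = Uᵀ * (B⁻¹ᵀ * Bᵀ) * (B * B⁻¹) * U := by
          rw [hB, Matrix.transpose_mul]; noncomm_ring
      _ = 1 := by rw [h1, h3, mul_one, mul_one, hU]
  · calc Uᵀ * B * E * (B⁻¹ * U) = Uᵀ * (B * E * B⁻¹ * U) := by noncomm_ring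
      _ = Matrix.diagonal lam := by rw [hHU, ← mul_assoc, hU, one_mul]
  · intro a
    rw [← Matrix.mulVec_mulVec, hUw]

end MetricAlgebra

/-! ### Smooth functions on a coordinate domain as a `MetricAlgebra` -/

namespace ChartGeom

open Matrix TopologicalSpace

variable (U : Opens E4)

/-- Openness of `U` makes derivatives on `U` independent of the values off `U`, so the arbitrary
extension chosen by `rep` does no harm. -/
lemma pd_congr {u w : E4 → ℝ} (h : ∀ z ∈ U, u z = w z) (i : Fin 4) {z : E4} (hz : z ∈ U) :
    pd i u z = pd i w z := by
  have : u =ᶠ[nhds z] w := Filter.eventually_of_mem (U.isOpen.mem_nhds hz) h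
  rw [pd, pd, this.fderiv_eq]

variable {U}

lemma contDiffOn_pd {u : E4 → ℝ} (hu : ContDiffOn ℝ ∞ u U) (i : Fin 4) :
    ContDiffOn ℝ ∞ (pd i u) U :=
  (hu.fderiv_of_isOpen U.isOpen (by simp)).clm_apply contDiffOn_const

lemma differentiableAt_of_smooth {u : E4 → ℝ} (hu : ContDiffOn ℝ ∞ u U) {z : E4} (hz : z ∈ U) :
    DifferentiableAt ℝ u z :=
  (hu.contDiffAt (U.isOpen.mem_nhds hz)).differentiableAt (by simp)

lemma pd_comm {u : E4 → ℝ} (hu : ContDiffOn ℝ ∞ u U) (i j : Fin 4) {z : E4} (hz : z ∈ U) :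
    pd i (pd j u) z = pd j (pd i u) z := by
  have hat : ContDiffAt ℝ ∞ u z := hu.contDiffAt (U.isOpen.mem_nhds hz)
  have hd : DifferentiableAt ℝ (fderiv ℝ u) z :=
    (hat.fderiv_right (m := ∞) (by simp)).differentiableAt (by simp)
  have h : ∀ i j, pd i (pd j u) z = fderiv ℝ (fderiv ℝ u) z (EuclideanSpace.single i 1)
      (EuclideanSpace.single j 1) := by
    intro i j
    change fderiv ℝ (fun y => fderiv ℝ u y (EuclideanSpace.single j 1)) z _ = _
    rw [fderiv_clm_apply hd (differentiableAt_const _)]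
    simp
  rw [h, h]
  have h2 : minSmoothness ℝ 2 ≤ (∞ : WithTop ℕ∞) := by
    rw [minSmoothness_of_isRCLikeNormedField]; exact WithTop.coe_le_coe.mpr le_top
  exact (hat.isSymmSndFDerivAt h2).eq _ _

variable (U)

/-- The algebra of smooth functions on an open set of coordinate space. -/
def smoothAlg : Subalgebra ℝ (U → ℝ) where
  carrier := {u | ∃ w : E4 → ℝ, ContDiffOn ℝ ∞ w U ∧ ∀ z : U, w z = u z}
  mul_mem' := by
    rintro a b ⟨w, hw, h⟩ ⟨w', hw', h'⟩
    exact ⟨fun z => w z * w' z, hw.mul hw', fun z => by simp [h, h']⟩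
  add_mem' := by
    rintro a b ⟨w, hw, h⟩ ⟨w', hw', h'⟩
    exact ⟨fun z => w z + w' z, hw.add hw', fun z => by simp [h, h']⟩
  algebraMap_mem' r := ⟨fun _ => r, contDiffOn_const, fun _ => rfl⟩

/-- The commutative ring of smooth functions on an open set of coordinate space. -/
def SmoothFn : Type := smoothAlg U

instance : CommRing (SmoothFn U) := inferInstanceAs (CommRing (smoothAlg U))

instance : Algebra ℝ (SmoothFn U) := inferInstanceAs (Algebra ℝ (smoothAlg U))

variable {U}

/-- A smooth function on `U` as an element of the algebra. -/
def toSmooth (w : E4 → ℝ) (hw : ContDiffOn ℝ ∞ w U) : SmoothFn U :=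
    ⟨fun z => w z, w, hw, fun _ => rfl⟩

/-- Evaluation at a point. -/
def evalAt (z : U) : SmoothFn U →ₐ[ℝ] ℝ :=
    (Pi.evalAlgHom ℝ (fun _ : U => ℝ) z).comp (smoothAlg U).val

lemma evalAt_toSmooth (w : E4 → ℝ) (hw : ContDiffOn ℝ ∞ w U) (z : U) :
    evalAt z (toSmooth w hw) = w z := rfl

lemma SmoothFn.ext {u w : SmoothFn U} (h : ∀ z, evalAt z u = evalAt z w) : u = w :=
  Subtype.ext (funext h)

/-- A function on coordinate space representing an element of the algebra. -/
def rep (u : SmoothFn U) : E4 → ℝ := u.2.choose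

lemma contDiffOn_rep (u : SmoothFn U) : ContDiffOn ℝ ∞ (rep u) U := u.2.choose_spec.1

lemma rep_apply (u : SmoothFn U) (z : U) : rep u z = evalAt z u := u.2.choose_spec.2 z

/-- The coordinate derivations. -/
def der (i : Fin 4) : Derivation ℝ (SmoothFn U) (SmoothFn U) :=
  Derivation.mk'
    { toFun := fun u => toSmooth (pd i (rep u)) (contDiffOn_pd (contDiffOn_rep u) i)
      map_add' := fun u w => SmoothFn.ext fun z => by
        have hu := differentiableAt_of_smooth (contDiffOn_rep u) z.2
        have hw := differentiableAt_of_smooth (contDiffOn_rep w) z.2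
        rw [map_add, evalAt_toSmooth, evalAt_toSmooth, evalAt_toSmooth,
          pd_congr U (w := rep u + rep w) _ i z.2]
        · rw [pd, fderiv_add hu hw]; rfl
        · intro y hy
          have := rep_apply (u + w) ⟨y, hy⟩
          rw [map_add, ← rep_apply, ← rep_apply] at this
          exact this
      map_smul' := fun c u => SmoothFn.ext fun z => by
        have hu := differentiableAt_of_smooth (contDiffOn_rep u) z.2
        rw [map_smul, evalAt_toSmooth, evalAt_toSmooth, pd_congr U (w := c • rep u) _ i z.2]
        · rw [pd, fderiv_const_smul hu]; rfl
        · intro y hy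
          have := rep_apply (c • u) ⟨y, hy⟩
          rw [map_smul, ← rep_apply] at this
          exact this }
    (fun u w => SmoothFn.ext fun z => by
        have hu := differentiableAt_of_smooth (contDiffOn_rep u) z.2
        have hw := differentiableAt_of_smooth (contDiffOn_rep w) z.2
        simp only [LinearMap.coe_mk, AddHom.coe_mk, map_add, smul_eq_mul, map_mul, evalAt_toSmooth]
        rw [pd_congr U (w := fun y => rep u y * rep w y) _ i z.2]
        · rw [pd, fderiv_fun_mul hu hw, ← rep_apply, ← rep_apply]; rfl
        · intro y hy
          have := rep_apply (u * w) ⟨y, hy⟩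
          rw [map_mul, ← rep_apply, ← rep_apply] at this
          exact this)

lemma evalAt_der {u : SmoothFn U} {w : E4 → ℝ} (h : ∀ z : U, evalAt z u = w z) (i : Fin 4) (z : U) :
    evalAt z (der i u) = pd i w z := by
  change pd i (rep u) z = _
  refine pd_congr U (fun y hy => ?_) i z.2
  rw [← h ⟨y, hy⟩, ← rep_apply]

lemma der_comm (i j : Fin 4) (u : SmoothFn U) : der i (der j u) = der j (der i u) := by
  refine SmoothFn.ext fun z => ?_
  have h : ∀ j (z : U), evalAt z (der j u) = pd j (rep u) z := fun _ _ => rfl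
  rw [evalAt_der (h j), evalAt_der (h i), pd_comm (contDiffOn_rep u) i j z.2]

lemma contDiffOn_det {n : Type*} [Fintype n] [DecidableEq n] {g : E4 → Matrix n n ℝ}
    (hg : ∀ i j, ContDiffOn ℝ ∞ (fun z => g z i j) U) : ContDiffOn ℝ ∞ (fun z => (g z).det) U := by
  simp only [Matrix.det_apply]
  refine ContDiffOn.sum fun s _ => ContDiffOn.const_smul _ (contDiffOn_prod fun i _ => hg _ _)

lemma contDiffOn_inv {g : E4 → Matrix (Fin 4) (Fin 4) ℝ}
    (hg : ∀ i j, ContDiffOn ℝ ∞ (fun z => g z i j) U) (hdet : ∀ z ∈ U, (g z).det ≠ 0)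
    (i j : Fin 4) : ContDiffOn ℝ ∞ (fun z => (g z)⁻¹ i j) U := by
  -- Cramer's rule.
  simp only [Matrix.inv_def, Matrix.smul_apply, Ring.inverse_eq_inv', smul_eq_mul,
    Matrix.adjugate_apply]
  refine ((contDiffOn_det hg).inv hdet).mul (contDiffOn_det fun a b => ?_)
  simp only [Matrix.updateRow_apply]
  split_ifs
  · exact contDiffOn_const
  · exact hg a b

/-- The metric data of a smooth field of symmetric invertible matrices. -/
def metricAlgebra (g : E4 → Matrix (Fin 4) (Fin 4) ℝ)
    (hg : ∀ i j, ContDiffOn ℝ ∞ (fun z => g z i j) U) (hdet : ∀ z ∈ U, (g z).det ≠ 0)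
    (hsymm : ∀ z ∈ U, (g z)ᵀ = g z) : MetricAlgebra (SmoothFn U) where
  d := der
  d_comm := der_comm
  g := Matrix.of fun i j => toSmooth (fun z => g z i j) (hg i j)
  ginv := Matrix.of fun i j => toSmooth (fun z => (g z)⁻¹ i j) (contDiffOn_inv hg hdet i j)
  g_mul_ginv := by
    refine Matrix.ext fun i j => SmoothFn.ext fun z => ?_
    have h := congrFun (congrFun (Matrix.mul_nonsing_inv (g z)
      (isUnit_iff_ne_zero.mpr (hdet z z.2))) i) j
    rw [Matrix.mul_apply] at h
    simp only [Matrix.mul_apply, Matrix.of_apply, map_sum, map_mul, evalAt_toSmooth, h,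
      Matrix.one_apply]
    split_ifs <;> simp
  g_symm := by
    refine Matrix.ext fun i j => SmoothFn.ext fun z => ?_
    exact congrFun (congrFun (hsymm z z.2) i) j

/-! ### Evaluation of the abstract tensors in coordinates -/

section Transfer

variable {g : E4 → Matrix (Fin 4) (Fin 4) ℝ}
    (hg : ∀ i j, ContDiffOn ℝ ∞ (fun z => g z i j) U) (hdet : ∀ z ∈ U, (g z).det ≠ 0)
    (hsymm : ∀ z ∈ U, (g z)ᵀ = g z) (z : U)

lemma evalAt_ginv (i j : Fin 4) :
    evalAt z ((metricAlgebra g hg hdet hsymm).ginv i j) = (g z)⁻¹ i j := rfl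

lemma evalAt_conn (i l k : Fin 4) :
    evalAt z ((metricAlgebra g hg hdet hsymm).conn i l k) = christoffel g l i k z := by
  have hd : ∀ m i j,
      evalAt z ((metricAlgebra g hg hdet hsymm).d m ((metricAlgebra g hg hdet hsymm).g i j))
        = pd m (fun y => g y i j) z :=
    fun m i j => evalAt_der (fun _ => rfl) m z
  simp only [MetricAlgebra.conn, MetricAlgebra.chr, Matrix.smul_apply, Matrix.mul_apply,
    Matrix.of_apply, map_smul, map_sum, map_mul, map_add, map_sub, hd, christoffel, smul_eq_mul,
    evalAt_ginv]

/-- The form indices are exchanged: by the sign convention of `curvature`, `Rm(∂ᵢ, ∂ⱼ)` is the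
commutator `[∇_j, ∇_i]`. -/
lemma evalAt_curv (i j l k : Fin 4) :
    evalAt z ((metricAlgebra g hg hdet hsymm).curv j i l k) = curvature g l i j k z := by
  have hd : ∀ m i l k,
      evalAt z ((metricAlgebra g hg hdet hsymm).d m ((metricAlgebra g hg hdet hsymm).conn i l k))
        = pd m (christoffel g l i k) z :=
    fun m i l k => evalAt_der (fun z => evalAt_conn hg hdet hsymm z i l k) m z
  simp only [MetricAlgebra.curv, Matrix.sub_apply, Matrix.add_apply, Matrix.mul_apply, map_sub,
    map_add, map_sum, map_mul, MetricAlgebra.mapD_apply, hd, evalAt_conn, curvature,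
    Finset.sum_sub_distrib]
  ring

lemma evalAt_ric : (metricAlgebra g hg hdet hsymm).ric.map (evalAt z) = ricci g z := by
  ext i j
  simp only [MetricAlgebra.ric, ricci, Matrix.map_apply, Matrix.of_apply, map_sum, evalAt_curv]

lemma map_ginv : (metricAlgebra g hg hdet hsymm).ginv.map (evalAt z) = (g z)⁻¹ := rfl

lemma evalAt_ricE : (metricAlgebra g hg hdet hsymm).ricE.map (evalAt z) = ricciEnd g z := by
  rw [MetricAlgebra.ricE, Matrix.map_mul, evalAt_ric, map_ginv, ricciEnd]

variable {u v : SmoothFn U} {u' v' : E4 → ℝ} (hu : ∀ z : U, evalAt z u = u' z)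
  (hv : ∀ z : U, evalAt z v = v' z)

include hu in
lemma evalAt_hess : ((metricAlgebra g hg hdet hsymm).hess u).map (evalAt z) = hessian g u' z := by
  have h1 : ∀ k (z : U), evalAt z ((metricAlgebra g hg hdet hsymm).d k u) = pd k u' z :=
      fun k z => evalAt_der hu k z
  have h2 : ∀ i j,
      evalAt z ((metricAlgebra g hg hdet hsymm).d i ((metricAlgebra g hg hdet hsymm).d j u))
        = pd i (pd j u') z :=
    fun i j => evalAt_der (h1 j) i z
  ext i j
  simp only [MetricAlgebra.hess, hessian, Matrix.map_apply, Matrix.of_apply, map_sub, map_sum,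
    map_mul, h1, h2, evalAt_conn]

include hu hv in
lemma evalAt_gradInner :
    evalAt z ((metricAlgebra g hg hdet hsymm).gradInner u v) = gradInner g u' v' z := by
  have h1 : ∀ k, evalAt z ((metricAlgebra g hg hdet hsymm).d k u) = pd k u' z :=
      fun k => evalAt_der hu k z
  have h2 : ∀ k, evalAt z ((metricAlgebra g hg hdet hsymm).d k v) = pd k v' z :=
      fun k => evalAt_der hv k z
  simp only [MetricAlgebra.gradInner, gradInner, map_sum, map_mul, h1, h2, evalAt_ginv]

include hu hv in
lemma evalAt_driftLap :
    evalAt z ((metricAlgebra g hg hdet hsymm).driftLap u v) = driftLaplacian g u' v' z := by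
  rw [MetricAlgebra.driftLap, map_sub, evalAt_gradInner hg hdet hsymm z hu hv,
    MetricAlgebra.ev_trace, Matrix.map_mul, evalAt_hess hg hdet hsymm z hv, map_ginv,
    driftLaplacian, laplacian]

lemma evalAt_trace_ricE_cube :
    evalAt z ((metricAlgebra g hg hdet hsymm).ricE ^ 3).trace = trRicCubed g z := by
  rw [MetricAlgebra.ev_trace, trRicCubed, ← evalAt_ricE hg hdet hsymm z, pow_succ, pow_two,
    Matrix.map_mul, Matrix.map_mul, pow_succ, pow_two]

end Transfer

/-! ### The estimate on a coordinate domain, including critical points of `f` -/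

variable {U : Opens E4} {g : E4 → Matrix (Fin 4) (Fin 4) ℝ} {f : E4 → ℝ}

lemma gradInner_self_eq (u : E4 → ℝ) (z : E4) :
    gradInner g u u z = (fun i => pd i u z) ⬝ᵥ ((g z)⁻¹ *ᵥ fun i => pd i u z) := by
  simp only [gradInner, dotProduct, Matrix.mulVec, Finset.mul_sum]
  exact Finset.sum_congr rfl fun i _ => Finset.sum_congr rfl fun j _ => by ring

lemma gradInner_self_nonneg (u : E4 → ℝ) {z : E4} (hg : (g z).PosDef) :
    0 ≤ gradInner g u u z := by
  rw [gradInner_self_eq]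
  simpa using hg.inv.posSemidef.dotProduct_mulVec_nonneg (fun i => pd i u z)

lemma pd_eq_zero_of_gradInner_self (u : E4 → ℝ) {z : E4} (hg : (g z).PosDef)
    (h : gradInner g u u z = 0) (i : Fin 4) : pd i u z = 0 := by
  by_contra hi
  have hne : (fun i => pd i u z) ≠ 0 := fun h0 => hi (congrFun h0 i)
  have := hg.inv.dotProduct_mulVec_pos hne
  rw [gradInner_self_eq] at h
  simp only [star_trivial] at this
  exact this.ne' h

theorem local_estimate (hg : ∀ i j, ContDiffOn ℝ ∞ (fun z => g z i j) U)
    (hpos : ∀ z ∈ U, (g z).PosDef) (hf : ContDiffOn ℝ ∞ f U)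
    (hsol : ∀ z ∈ U, ricci g z + hessian g f z = (1 / 2 : ℝ) • g z)
    (hnorm : ∀ z ∈ U, gradInner g f f z = f z) (hscal : ∀ z ∈ U, scalarCurvature g z = 1)
    {y : E4} (hy : y ∈ U) :
    9 * (f y * (trRicCubed g y - 1 / 4))
      ≤ driftLaplacian g f (fun z => f z * (trRicCubed g z - 1 / 4)) y := by
  have hdet : ∀ z ∈ U, (g z).det ≠ 0 := fun z hz => (hpos z hz).det_pos.ne'
  have hsymm : ∀ z ∈ U, (g z)ᵀ = g z := fun z hz => by
    have h := (hpos z hz).isHermitian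
    rwa [Matrix.IsHermitian, Matrix.conjTranspose_eq_transpose_of_trivial] at h
  set M := metricAlgebra g hg hdet hsymm with hM
  set F : SmoothFn U := toSmooth f hf with hF
  have hFe : ∀ z : U, evalAt z F = f z := fun _ => rfl
  have H : M.IsSoliton F := by
    refine ⟨Matrix.ext fun i j => SmoothFn.ext fun z => ?_, SmoothFn.ext fun z => ?_,
      SmoothFn.ext fun z => ?_⟩
    · have h := congrFun (congrFun (hsol z z.2) i) j
      rw [← evalAt_ric hg hdet hsymm z, ← evalAt_hess hg hdet hsymm z hFe] at h
      rw [Matrix.add_apply, map_add, Matrix.smul_apply, map_smul]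
      exact h
    · rw [hM, evalAt_gradInner hg hdet hsymm z hFe hFe, hnorm z z.2, hFe]
    · rw [MetricAlgebra.ev_trace, hM, evalAt_ricE, map_one]
      exact hscal z z.2
  set h : SmoothFn U := (M.ricE ^ 3).trace - algebraMap ℝ (SmoothFn U) (1 / 4) with hh
  have hhe : ∀ z : U, evalAt z h = trRicCubed g z - 1 / 4 := by
    intro z
    rw [hh, map_sub, AlgHom.commutes, hM, evalAt_trace_ricE_cube]; rfl
  have hdrift : ∀ z : U, evalAt z (M.driftLap F (F * h))
      = driftLaplacian g f (fun z => f z * (trRicCubed g z - 1 / 4)) z := fun z =>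
    evalAt_driftLap hg hdet hsymm z hFe fun z => by rw [map_mul, hhe, hFe]
  have hnn : ∀ z ∈ U, 0 ≤ f z := fun z hz => by
    rw [← hnorm z hz]; exact gradInner_self_nonneg f (hpos z hz)
  have key : ∀ z : U, 0 < f z → 9 * (f z * evalAt z h) ≤ evalAt z (M.driftLap F (F * h))
      ∧ 0 ≤ evalAt z h := by
    intro z hz
    have hE := congrArg (fun X => X.map (evalAt z)) H.ricE_selfAdjoint
    simp only [Matrix.map_mul, Matrix.transpose_map] at hE
    have hEv : M.ricE.map (evalAt z) *ᵥ (fun a => evalAt z (M.grad F a 0)) = 0 := by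
      ext a
      have h := congrArg (evalAt z) (congrFun (congrFun H.ricE_mul_grad a) 0)
      rw [Matrix.mul_apply, map_sum, Matrix.zero_apply, map_zero] at h
      simp only [map_mul] at h
      exact h
    -- As `|∇f|² = f > 0` at `z`.
    have hv : (fun a => evalAt z (M.grad F a 0)) ≠ 0 := by
      intro h0
      have h1 : evalAt z (M.gradInner F F) = 0 := by
        rw [MetricAlgebra.gradInner_eq, map_sum]
        exact Finset.sum_eq_zero fun i _ => by
          rw [map_mul, show evalAt z (M.grad F i 0) = 0 from congrFun h0 i, zero_mul]
      rw [H.norm, hFe] at h1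
      exact hz.ne' h1
    have hgp : (M.g.map (evalAt z)).PosDef := hpos z z.2
    rw [← hFe z]
    exact MetricAlgebra.drift_estimate M H (evalAt z)
      (MetricAlgebra.hasAdaptedFrame hgp hE hEv hv)
  set y' : U := ⟨y, hy⟩
  suffices hs : 9 * (f y * evalAt y' h) ≤ evalAt y' (M.driftLap F (F * h)) by
    rwa [hdrift, hhe] at hs
  rcases (hnn y hy).lt_or_eq with hlt | heq
  · exact (key y' hlt).1
  have hfy : f y = 0 := heq.symm
  have hpd : ∀ i, pd i f y = 0 :=
      pd_eq_zero_of_gradInner_self f (hpos y hy) (by rw [hnorm y hy, hfy])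
  have hgrad0 : ∀ w, evalAt y' (M.gradInner F w) = 0 := by
    intro w
    simp only [MetricAlgebra.gradInner, map_sum, map_mul]
    have : ∀ i, evalAt y' (M.d i F) = 0 := fun i => (evalAt_der hFe i y').trans (hpd i)
    simp [this]
  have hF0 : evalAt y' F = 0 := hfy
  have h1F : evalAt y' (1 - F) = 1 := by rw [map_sub, map_one, hF0, sub_zero]
  -- At a zero of `f` the product rule leaves only `h Δ_f f = h`, so the claim becomes `0 ≤ h`.
  rw [MetricAlgebra.driftLap_mul, H.driftLap_self, map_add, map_add, map_mul, map_mul, map_mul,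
    h1F, hgrad0, hF0, hfy]
  simp only [zero_mul, mul_zero, mul_one, add_zero]
  have hcont : ContinuousAt (fun z => trRicCubed g z - 1 / 4) y := by
    have h1 : ∀ z ∈ U, rep h z = trRicCubed g z - 1 / 4 := fun z hz => by
      rw [← hhe ⟨z, hz⟩, ← rep_apply]
    have h2 : ContinuousAt (rep h) y :=
      (contDiffOn_rep h).continuousOn.continuousAt (U.isOpen.mem_nhds hy)
    exact h2.congr (Filter.eventually_of_mem (U.isOpen.mem_nhds hy) h1)
  -- Otherwise `f` vanishes near `y`, so `∇²f = 0` and `Ric = g/2` at `y`, giving `S = 2` instead of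
  -- 1.
  have hfreq : ∃ᶠ z in nhds y, 0 < f z := by
    intro hev
    have h0 : ∀ᶠ z in nhds y, f z = 0 := by
      filter_upwards [hev, U.isOpen.mem_nhds hy] with z hz hzU
      exact le_antisymm (not_lt.mp hz) (hnn z hzU)
    have hpd0 : ∀ i, pd i f =ᶠ[nhds y] fun _ => 0 := by
      intro i
      filter_upwards [h0.eventually_nhds] with z hz
      have : f =ᶠ[nhds z] fun _ => 0 := hz
      rw [pd, this.fderiv_eq]; simp
    have hhess : hessian g f y = 0 := by
      ext i j
      have h2 : pd i (pd j f) y = 0 := by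
        rw [pd, (hpd0 j).fderiv_eq]; simp
      simp [hessian, h2, hpd]
    have hS := hscal y hy
    have hR := hsol y hy
    rw [hhess, add_zero] at hR
    rw [scalarCurvature, ricciEnd, hR, Matrix.mul_smul,
      Matrix.nonsing_inv_mul _ (isUnit_iff_ne_zero.mpr (hdet y hy)), Matrix.trace_smul,
      Matrix.trace_one] at hS
    norm_num at hS
  rw [hhe]
  by_contra hneg
  have hlt : trRicCubed g y - 1 / 4 < 0 := not_le.mp hneg
  have hev : ∀ᶠ z in nhds y, trRicCubed g z - 1 / 4 < 0 := hcont.eventually_lt_const hlt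
  obtain ⟨z, hz, hz1, hz2⟩ := (hfreq.and_eventually
    (hev.and (U.isOpen.mem_nhds hy))).exists
  have := (key ⟨z, hz2⟩ hz).2
  rw [hhe] at this
  exact absurd hz1 (not_lt.mpr this)

/-! ### Positivity and smoothness of the metric in a chart -/

section Chart

variable {M : Type*} [TopologicalSpace M] [ChartedSpace E4 M]
  [Bundle.RiemannianBundle (fun x : M => TangentSpace (𝓡 4) x)]

lemma metric_symm (φ : OpenPartialHomeomorph M E4) (y : E4) : (metric φ y)ᵀ = metric φ y := by
  ext i j
  simp only [metric, Matrix.transpose_apply, Matrix.of_apply]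
  exact real_inner_comm _ _

variable [IsManifold (𝓡 4) ∞ M]

lemma mfderiv_symm_injective {φ : OpenPartialHomeomorph M E4}
    (hφ : φ ∈ IsManifold.maximalAtlas (𝓡 4) ∞ M) {y : E4} (hy : y ∈ φ.target) :
    Function.Injective (mfderiv (𝓡 4) (𝓡 4) φ.symm y) := by
  have h : φ.MDifferentiable (𝓡 4) (𝓡 4) :=
    ⟨(contMDiffOn_of_mem_maximalAtlas hφ).mdifferentiableOn (by simp),
      (contMDiffOn_symm_of_mem_maximalAtlas hφ).mdifferentiableOn (by simp)⟩
  exact h.symm.mfderiv_injective hy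

lemma metric_posDef {φ : OpenPartialHomeomorph M E4}
    (hφ : φ ∈ IsManifold.maximalAtlas (𝓡 4) ∞ M) {y : E4} (hy : y ∈ φ.target) :
    (metric φ y).PosDef := by
  refine Matrix.PosDef.of_dotProduct_mulVec_pos ?_ fun x hx => ?_
  · rw [Matrix.IsHermitian, Matrix.conjTranspose_eq_transpose_of_trivial, metric_symm]
  · set D := mfderiv (𝓡 4) (𝓡 4) φ.symm y
    set e : Fin 4 → E4 := fun i => EuclideanSpace.single i (1 : ℝ)
    set X : E4 := ∑ i, x i • e i with hX
    have hX0 : X ≠ 0 := by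
      intro h
      apply hx
      ext i
      have := congrArg (fun z : E4 => z i) h
      simpa [hX, e, Finset.sum_apply, Pi.single_apply] using this
    -- The differential of the inverse chart is injective, so the quadratic form of the metric
    -- matrix at `x ≠ 0` is the squared norm of a nonzero tangent vector.
    have hDX : D X ≠ 0 := by
      intro h
      exact hX0 (mfderiv_symm_injective hφ hy (h.trans (map_zero D).symm))
    have hsum : D X = ∑ i, x i • D (e i) := by
      rw [hX]
      exact (map_sum D _ _).trans (Finset.sum_congr rfl fun i _ => map_smul D _ _)
    have hin : star x ⬝ᵥ metric φ y *ᵥ x = inner ℝ (D X) (D X) := by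
      rw [hsum, sum_inner]
      simp only [dotProduct, Matrix.mulVec, star_trivial]
      refine Finset.sum_congr rfl fun i _ => ?_
      rw [inner_sum, Finset.mul_sum]
      refine Finset.sum_congr rfl fun j _ => ?_
      rw [real_inner_smul_left, real_inner_smul_right, mul_comm (metric φ y i j)]
      rfl
    rw [hin]
    exact real_inner_self_pos.mpr hDX

/-- The coordinate fields are the tangent map of `φ.symm` composed with constant sections, hence
smooth along `φ.symm`; a smooth bundle metric pairs them to smooth functions. -/
lemma contDiffOn_metric [IsContMDiffRiemannianBundle (𝓡 4) ∞ E4 (fun x : M => TangentSpace (𝓡 4) x)]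
    {φ : OpenPartialHomeomorph M E4} (hφ : φ ∈ IsManifold.maximalAtlas (𝓡 4) ∞ M) (i j : Fin 4) :
    ContDiffOn ℝ ∞ (fun y => metric φ y i j) φ.target := by
  have hs : ∀ i : Fin 4, ContMDiffOn (𝓡 4) ((𝓡 4).prod (𝓡 4)) ∞
      (fun y : E4 => (⟨φ.symm y, mfderiv (𝓡 4) (𝓡 4) φ.symm y
          (EuclideanSpace.single i (1 : ℝ) : E4)⟩ :
        Bundle.TotalSpace E4 (fun x : M => TangentSpace (𝓡 4) x))) φ.target := by
    intro i
    have h1 := (contMDiffOn_symm_of_mem_maximalAtlas hφ).contMDiffOn_tangentMapWithin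
      (m := ∞) (by simp) φ.open_target.uniqueMDiffOn
    have h2 : ContMDiffOn (𝓡 4) ((𝓡 4).prod (𝓡 4)) ∞
      (fun y : E4 => (⟨y, (EuclideanSpace.single i (1 : ℝ) : E4)⟩ : TangentBundle (𝓡 4) E4))
        φ.target := by
      refine (contMDiffOn_vectorSpace_iff_contDiffOn
        (V := fun _ : E4 => (EuclideanSpace.single i (1 : ℝ) : E4))).mpr contDiffOn_const
    refine (h1.comp h2 (fun y hy => hy)).congr fun y hy => ?_
    simp only [Function.comp, tangentMapWithin, mfderivWithin_of_isOpen φ.open_target hy]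
  have h := (hs i).inner_bundle (hs j)
  exact contMDiffOn_iff_contDiffOn.mp h

end Chart

end ChartGeom
end

theorem lemma3p2
    {M : Type*} [MetricSpace M] [CompleteSpace M]
    [ChartedSpace ChartGeom.E4 M] [IsManifold (𝓡 4) ∞ M]
    [Bundle.RiemannianBundle (fun x : M => TangentSpace (𝓡 4) x)]
    [IsContMDiffRiemannianBundle (𝓡 4) ∞ ChartGeom.E4 (fun x : M => TangentSpace (𝓡 4) x)]
    [IsRiemannianManifold (𝓡 4) M]
    (f : M → ℝ) (hf : ContMDiff (𝓡 4) 𝓘(ℝ, ℝ) ∞ f)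
    -- the soliton equation `Ric + ∇²f = ½ g`
    (hsoliton : ∀ φ ∈ IsManifold.maximalAtlas (𝓡 4) ∞ M, ∀ y ∈ φ.target,
      ChartGeom.ricci (ChartGeom.metric φ) y
        + ChartGeom.hessian (ChartGeom.metric φ) (f ∘ φ.symm) y
      = (1 / 2 : ℝ) • ChartGeom.metric φ y)
    -- the normalization `|∇f|² = f`
    (hnorm : ∀ φ ∈ IsManifold.maximalAtlas (𝓡 4) ∞ M, ∀ y ∈ φ.target,
      ChartGeom.gradInner (ChartGeom.metric φ) (f ∘ φ.symm) (f ∘ φ.symm) y = f (φ.symm y))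
    -- the scalar curvature is `S = 1`
    (hscal : ∀ φ ∈ IsManifold.maximalAtlas (𝓡 4) ∞ M, ∀ y ∈ φ.target,
      ChartGeom.scalarCurvature (ChartGeom.metric φ) y = 1) :
    ∀ φ ∈ IsManifold.maximalAtlas (𝓡 4) ∞ M, ∀ y ∈ φ.target,
      9 * (f (φ.symm y) * (ChartGeom.trRicCubed (ChartGeom.metric φ) y - 1 / 4))
        ≤ ChartGeom.driftLaplacian (ChartGeom.metric φ) (f ∘ φ.symm)
            (fun z => f (φ.symm z) * (ChartGeom.trRicCubed (ChartGeom.metric φ) z - 1 / 4)) y := by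
  intro φ hφ y hy
  have hfs : ContDiffOn ℝ ∞ (f ∘ φ.symm) φ.target :=
    contMDiffOn_iff_contDiffOn.mp
      (hf.comp_contMDiffOn (contMDiffOn_symm_of_mem_maximalAtlas hφ))
  exact ChartGeom.local_estimate (U := ⟨φ.target, φ.open_target⟩) (f := f ∘ φ.symm)
    (ChartGeom.contDiffOn_metric hφ) (fun z hz => ChartGeom.metric_posDef hφ hz) hfs
    (hsoliton φ hφ) (hnorm φ hφ) (hscal φ hφ) hy
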